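/- Let $(M,h)$ be a smooth Lorentzian manifold of dimension $n+2$, $n\ge 0$, with Levi-Civita connection $\nabla$ and curvature tensor $\mathcal R$, and let $X$ be a smooth nowhere vanishing light-like vector field ($h(X,X)=0$) that is recurrent, i.e. $\nabla X=\Theta\otimes X$ for a one-form $\Theta$. Put $\Xi=\mathbb R X$ and $\Xi^\perp=\{U\in TM\mid h(U,X)=0\}\supset\Xi$. We say that $(M,h)$ has light-like hypersurface curvature (with respect to $X$) if $\mathcal R(U,V)W\in\Xi$ for all $x\in M$ and all $U,V,W\in\Xi^\perp_x$. A light-like hypersurface defined by $X$ is a connected, injectively immersed smooth manifold $\mathcal N\subset M$ of dimension $n+1$ with $T_q\mathcal N=\Xi^\perp_q$ for all $q\in\mathcal N$ (a connected integral manifold of $\Xi^\perp$; one through $p$ is denoted by $\mathcal X_p^\perp$). Let $\mathring\nabla$ be the connection that $\nabla$ induces on $\mathcal N$; the restricted screen bundle $\mathring{\mathcal S}=(\Xi^\perp/\Xi)|_{\mathcal N}$ over $\mathcal N$ carries the connection $\nabla^{\mathring{\mathcal S}}_U[V]=[\mathring\nabla_UV]$ for $U\in T\mathcal N$ and $V\in\Gamma(T\mathcal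 N)$. It is called flat if its curvature vanishes. Then $(M,h)$ has light-like hypersurface curvature if and only if over every light-like hypersurface defined by $X$ the connection $\nabla^{\mathring{\mathcal S}}$ is flat. It suffices to know this for one hypersurface through each point: $(M,h)$ has light-like hypersurface curvature if and only if through every $p\in M$ there is a light-like hypersurface $\mathcal X_p^\perp$ defined by $X$ over which $\nabla^{\mathring{\mathcal S}}$ is flat. -/

import Mathlib

open Bundle FiberBundle VectorField Module
open scoped Manifold ContDiff Topology

universe u

noncomputable section

set_option linter.unusedSectionVars false

section General

variable {E : Type*} [NormedAddCommGroup E] [NormedSpace ℝ E] [FiniteDimensional ℝ E]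
  {H : Type*} [TopologicalSpace H] (I : ModelWithCorners ℝ E H)
  (M : Type*) [TopologicalSpace M] [ChartedSpace H M] [IsManifold I ∞ M]

/-- A smooth Lorentzian metric on the manifold `M`: a smooth field of symmetric bilinear forms of
signature `(-, +, …, +)`. The last field says that there is a time-like vector whose orthogonal
complement is positive definite. -/
structure LorentzianMetric where
  inner (x : M) : TangentSpace I x →L[ℝ] TangentSpace I x →L[ℝ] ℝ
  symm (x : M) (v w : TangentSpace I x) : inner x v w = inner x w v
  contMDiff : ContMDiff I (I.prod 𝓘(ℝ, E →L[ℝ] E →L[ℝ] ℝ)) ∞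
    (fun x ↦ TotalSpace.mk' (E →L[ℝ] E →L[ℝ] ℝ)
      (E := fun x : M ↦ TangentSpace I x →L[ℝ] TangentSpace I x →L[ℝ] ℝ) x (inner x))
  signature (x : M) : ∃ T : TangentSpace I x, inner x T T < 0 ∧
    ∀ v, inner x T v = 0 → v ≠ 0 → 0 < inner x v v

variable {I M}

namespace LorentzianMetric

variable (h : LorentzianMetric I M)

lemma eq_zero_of_inner {x : M} {v : TangentSpace I x} (hv : ∀ w, h.inner x v w = 0) : v = 0 := by
  obtain ⟨T, -, hT⟩ := h.signature x
  by_contra hne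
  have := hT v (by rw [h.symm, hv]) hne
  rw [hv] at this
  exact lt_irrefl _ this

lemma exists_sharp (x : M) :
    ∃ S : (TangentSpace I x →L[ℝ] ℝ) →L[ℝ] TangentSpace I x,
      ∀ α w, h.inner x (S α) w = α w := by
  let B : E →L[ℝ] E →L[ℝ] ℝ := h.inner x
  have hinj : Function.Injective B.toLinearMap := by
    rw [← LinearMap.ker_eq_bot, LinearMap.ker_eq_bot']
    intro v hv
    exact h.eq_zero_of_inner (x := x) (v := v) fun w ↦ congrArg (fun f : E →L[ℝ] ℝ ↦ f w) hv
  have hfin : finrank ℝ E = finrank ℝ (E →L[ℝ] ℝ) := by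
    rw [← (LinearMap.toContinuousLinearMap (𝕜 := ℝ) (E := E) (F' := ℝ)).finrank_eq]
    exact Subspace.dual_finrank_eq.symm
  let e : E ≃ₗ[ℝ] (E →L[ℝ] ℝ) := LinearEquiv.ofInjectiveOfFinrankEq B.toLinearMap hinj hfin
  let S : (E →L[ℝ] ℝ) →L[ℝ] E := LinearMap.toContinuousLinearMap e.symm.toLinearMap
  refine ⟨S, fun α w ↦ ?_⟩
  have : e (e.symm α) = α := e.apply_symm_apply α
  exact congrArg (fun f : E →L[ℝ] ℝ ↦ f w) this

/-- The vector `α^♯` metrically dual to a covector `α`, that is `h(α^♯, w) = α(w)`. -/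
def sharp (x : M) : (TangentSpace I x →L[ℝ] ℝ) →L[ℝ] TangentSpace I x :=
  (h.exists_sharp x).choose

lemma inner_sharp (x : M) (α : TangentSpace I x →L[ℝ] ℝ) (w : TangentSpace I x) :
    h.inner x (h.sharp x α) w = α w :=
  (h.exists_sharp x).choose_spec α w

/-- The right-hand side of the Koszul formula: the value at `x` of
`½ (U h(Y,W) + Y h(U,W) - W h(U,Y) + h([U,Y],W) - h([U,W],Y) - h([Y,W],U))`. -/
def koszul (Y U W : Π x : M, TangentSpace I x) (x : M) : ℝ :=
  (1 / 2 : ℝ) *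
    (d% (fun y ↦ h.inner y (Y y) (W y)) x (U x) + d% (fun y ↦ h.inner y (U y) (W y)) x (Y x)
      - d% (fun y ↦ h.inner y (U y) (Y y)) x (W x)
      + h.inner x (mlieBracket I U Y x) (W x) - h.inner x (mlieBracket I U W x) (Y x)
      - h.inner x (mlieBracket I Y W x) (U x))

lemma mdifferentiableAt_inner {V W : Π x : M, TangentSpace I x} {x : M}
    (hV : MDiffAt (T% V) x) (hW : MDiffAt (T% W) x) :
    MDiffAt (fun y ↦ h.inner y (V y) (W y)) x := by
  have h1 : MDiffAt (fun y ↦ TotalSpace.mk' (E →L[ℝ] E →L[ℝ] ℝ)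
      (E := fun x : M ↦ TangentSpace I x →L[ℝ] TangentSpace I x →L[ℝ] ℝ) y (h.inner y)) x :=
    (h.contMDiff x).mdifferentiableAt (by simp)
  have := MDifferentiableAt.clm_bundle_apply₂ (F₁ := E) (F₂ := E) (F₃ := ℝ)
    (E₃ := Trivial M ℝ) (b := id) h1 hV hW
  rw [mdifferentiableAt_totalSpace] at this
  exact this.2

lemma koszul_tensorial_left {Y W : Π x : M, TangentSpace I x} {x : M}
    (hY : MDiffAt (T% Y) x) (hW : MDiffAt (T% W) x) :
    TensorialAt I E (fun U ↦ h.koszul Y U W x) x where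
  smul {f U} hf hU := by
    have e1 : (fun y ↦ h.inner y ((f • U) y) (W y)) = fun y ↦ f y * h.inner y (U y) (W y) := by
      ext y; simp
    have e2 : (fun y ↦ h.inner y ((f • U) y) (Y y)) = fun y ↦ f y * h.inner y (U y) (Y y) := by
      ext y; simp
    simp only [koszul, e1, e2, mlieBracket_smul_left hf hU]
    rw [mvfderiv_fun_mul hf (h.mdifferentiableAt_inner hU hW),
      mvfderiv_fun_mul hf (h.mdifferentiableAt_inner hU hY)]
    simp
    ring
  add {U U'} hU hU' := by
    have e1 : (fun y ↦ h.inner y ((U + U') y) (W y)) =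
        fun y ↦ h.inner y (U y) (W y) + h.inner y (U' y) (W y) := by
      ext y; simp
    have e2 : (fun y ↦ h.inner y ((U + U') y) (Y y)) =
        fun y ↦ h.inner y (U y) (Y y) + h.inner y (U' y) (Y y) := by
      ext y; simp
    simp only [koszul, e1, e2, mlieBracket_add_left hU hU']
    rw [mvfderiv_fun_add (h.mdifferentiableAt_inner hU hW) (h.mdifferentiableAt_inner hU' hW),
      mvfderiv_fun_add (h.mdifferentiableAt_inner hU hY) (h.mdifferentiableAt_inner hU' hY)]
    simp
    ring

lemma koszul_tensorial_right {Y U : Π x : M, TangentSpace I x} {x : M}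
    (hY : MDiffAt (T% Y) x) (hU : MDiffAt (T% U) x) :
    TensorialAt I E (fun W ↦ h.koszul Y U W x) x where
  smul {f W} hf hW := by
    have e1 : (fun y ↦ h.inner y (Y y) ((f • W) y)) = fun y ↦ f y * h.inner y (Y y) (W y) := by
      ext y; simp
    have e2 : (fun y ↦ h.inner y (U y) ((f • W) y)) = fun y ↦ f y * h.inner y (U y) (W y) := by
      ext y; simp
    simp only [koszul, e1, e2, mlieBracket_smul_right hf hW]
    rw [mvfderiv_fun_mul hf (h.mdifferentiableAt_inner hY hW),
      mvfderiv_fun_mul hf (h.mdifferentiableAt_inner hU hW)]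
    simp [h.symm x (W x)]
    ring
  add {W W'} hW hW' := by
    have e1 : (fun y ↦ h.inner y (Y y) ((W + W') y)) =
        fun y ↦ h.inner y (Y y) (W y) + h.inner y (Y y) (W' y) := by
      ext y; simp
    have e2 : (fun y ↦ h.inner y (U y) ((W + W') y)) =
        fun y ↦ h.inner y (U y) (W y) + h.inner y (U y) (W' y) := by
      ext y; simp
    simp only [koszul, e1, e2, mlieBracket_add_right hW hW']
    rw [mvfderiv_fun_add (h.mdifferentiableAt_inner hY hW) (h.mdifferentiableAt_inner hY hW'),
      mvfderiv_fun_add (h.mdifferentiableAt_inner hU hW) (h.mdifferentiableAt_inner hU hW')]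
    simp
    ring

open scoped Classical in
/-- The endomorphism `U ↦ ∇_U Y` of `T_x M` given by the Koszul formula
(zero, by convention, if the vector field `Y` is not differentiable at `x`). -/
def nablaAux (Y : Π x : M, TangentSpace I x) (x : M) :
    TangentSpace I x →L[ℝ] TangentSpace I x :=
  if hY : MDiffAt (T% Y) x then
    h.sharp x ∘L TensorialAt.mkHom₂ (fun U W ↦ h.koszul Y U W x) x
      (fun _ hW ↦ h.koszul_tensorial_left hY hW) (fun _ hU ↦ h.koszul_tensorial_right hY hU)
  else 0

/-- The Koszul formula. -/
lemma inner_nablaAux {Y U W : Π x : M, TangentSpace I x} {x : M}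
    (hY : MDiffAt (T% Y) x) (hU : MDiffAt (T% U) x) (hW : MDiffAt (T% W) x) :
    h.inner x (h.nablaAux Y x (U x)) (W x) = h.koszul Y U W x := by
  rw [nablaAux, dif_pos hY, ContinuousLinearMap.comp_apply, inner_sharp]
  exact TensorialAt.mkHom₂_apply _ _ hU hW

lemma ext_inner {x : M} {A B : TangentSpace I x →L[ℝ] TangentSpace I x}
    (hAB : ∀ U W : Π x : M, TangentSpace I x, MDiffAt (T% U) x → MDiffAt (T% W) x →
      h.inner x (A (U x)) (W x) = h.inner x (B (U x)) (W x)) : A = B := by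
  ext u
  rw [← sub_eq_zero]
  refine h.eq_zero_of_inner fun w ↦ ?_
  have := hAB (extend E u) (extend E w) (mdifferentiableAt_extend ..) (mdifferentiableAt_extend ..)
  simp only [extend_apply_self] at this
  simp [this]

/-- The **Levi-Civita connection** of a Lorentzian metric. -/
def leviCivita : CovariantDerivative I E (TangentSpace I : M → Type _) where
  toFun := h.nablaAux
  isCovariantDerivativeOnUniv :=
    { add := by
        intro Y Y' x hY hY' _
        refine h.ext_inner fun U W hU hW ↦ ?_
        rw [h.inner_nablaAux (mdifferentiableAt_add_section hY hY') hU hW]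
        simp only [add_apply, map_add]
        rw [h.inner_nablaAux hY hU hW, h.inner_nablaAux hY' hU hW]
        have e1 : (fun y ↦ h.inner y ((Y + Y') y) (W y)) =
            fun y ↦ h.inner y (Y y) (W y) + h.inner y (Y' y) (W y) := by
          ext y; simp
        have e2 : (fun y ↦ h.inner y (U y) ((Y + Y') y)) =
            fun y ↦ h.inner y (U y) (Y y) + h.inner y (U y) (Y' y) := by
          ext y; simp
        simp only [koszul, e1, e2, mlieBracket_add_left hY hY', mlieBracket_add_right hY hY']
        rw [mvfderiv_fun_add (h.mdifferentiableAt_inner hY hW) (h.mdifferentiableAt_inner hY' hW),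
          mvfderiv_fun_add (h.mdifferentiableAt_inner hU hY) (h.mdifferentiableAt_inner hU hY')]
        simp
        ring
      leibniz := by
        intro Y f x hY hf _
        refine h.ext_inner fun U W hU hW ↦ ?_
        rw [h.inner_nablaAux (hf.smul_section hY) hU hW]
        simp only [add_apply, map_add, smul_apply, map_smul,
          ContinuousLinearMap.smulRight_apply]
        rw [h.inner_nablaAux hY hU hW]
        have e1 : (fun y ↦ h.inner y ((f • Y) y) (W y)) = fun y ↦ f y * h.inner y (Y y) (W y) := by
          ext y; simp
        have e2 : (fun y ↦ h.inner y (U y) ((f • Y) y)) = fun y ↦ f y * h.inner y (U y) (Y y) := by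
          ext y; simp
        simp only [koszul, e1, e2, mlieBracket_smul_left hf hY, mlieBracket_smul_right hf hY]
        rw [mvfderiv_fun_mul hf (h.mdifferentiableAt_inner hY hW),
          mvfderiv_fun_mul hf (h.mdifferentiableAt_inner hU hY)]
        simp [h.symm x (U x)]
        ring }

lemma leviCivita_torsionFree {U Y : Π x : M, TangentSpace I x} {x : M}
    (hU : MDiffAt (T% U) x) (hY : MDiffAt (T% Y) x) :
    h.leviCivita Y x (U x) - h.leviCivita U x (Y x) = mlieBracket I U Y x := by
  rw [← sub_eq_zero]
  refine h.eq_zero_of_inner fun w ↦ ?_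
  have hW : MDiffAt (T% (extend E w)) x := mdifferentiableAt_extend ..
  have h1 := h.inner_nablaAux hY hU hW
  have h2 := h.inner_nablaAux hU hY hW
  rw [extend_apply_self] at h1 h2
  simp only [map_sub, sub_apply]
  change h.inner x (h.nablaAux Y x (U x)) w - h.inner x (h.nablaAux U x (Y x)) w - _ = 0
  rw [h1, h2]
  have e1 : (fun y ↦ h.inner y (U y) (Y y)) = fun y ↦ h.inner y (Y y) (U y) := by
    ext y; exact h.symm y _ _
  simp only [koszul, e1, mlieBracket_swap_apply (V := Y) (W := U), extend_apply_self, map_neg,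
    neg_apply]
  ring

lemma leviCivita_metric {U Y W : Π x : M, TangentSpace I x} {x : M}
    (hU : MDiffAt (T% U) x) (hY : MDiffAt (T% Y) x) (hW : MDiffAt (T% W) x) :
    d% (fun y ↦ h.inner y (Y y) (W y)) x (U x) =
      h.inner x (h.leviCivita Y x (U x)) (W x) + h.inner x (Y x) (h.leviCivita W x (U x)) := by
  rw [h.symm x (Y x)]
  change _ = h.inner x (h.nablaAux Y x (U x)) (W x) + h.inner x (h.nablaAux W x (U x)) (Y x)
  rw [h.inner_nablaAux hY hU hW, h.inner_nablaAux hW hU hY]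
  have e1 : (fun y ↦ h.inner y (W y) (Y y)) = fun y ↦ h.inner y (Y y) (W y) := by
    ext y; exact h.symm y _ _
  have e2 := mlieBracket_swap_apply (I := I) (V := W) (W := Y) (x := x)
  simp only [koszul, e1, e2, map_neg, neg_apply]
  ring

end LorentzianMetric

/-- The curvature `R(U,V)W = ∇_U ∇_V W - ∇_V ∇_U W - ∇_{[U,V]} W` of a connection on the tangent
bundle, evaluated on vector fields. -/
def CovariantDerivative.curvature (cov : CovariantDerivative I E (TangentSpace I : M → Type _))
    (U V W : Π x : M, TangentSpace I x) (x : M) : TangentSpace I x :=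
  cov (fun y ↦ cov W y (V y)) x (U x) - cov (fun y ↦ cov W y (U y)) x (V x)
    - cov W x (mlieBracket I U V x)

namespace LorentzianMetric

variable (h : LorentzianMetric I M) (X : Π x : M, TangentSpace I x)

/-- `X` is a light-like vector field: `h(X,X) = 0` and `X` vanishes nowhere. -/
def IsLightlike : Prop := ∀ x, X x ≠ 0 ∧ h.inner x (X x) (X x) = 0

/-- `X` is recurrent: `∇X = Θ ⊗ X` for some one-form `Θ`. -/
def IsRecurrent : Prop :=
  ∃ Θ : Π x : M, TangentSpace I x →L[ℝ] ℝ, ∀ x u, h.leviCivita X x u = Θ x u • X x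

/-- The line `Ξ_x = ℝ · X_x`. -/
def line (_h : LorentzianMetric I M) (X : Π x : M, TangentSpace I x) (x : M) :
    Submodule ℝ (TangentSpace I x) := Submodule.span ℝ {X x}

/-- The hyperplane `Ξ_x^⊥ = {u | h(u, X) = 0}`. -/
def perp (x : M) : Submodule ℝ (TangentSpace I x) where
  carrier := {u | h.inner x u (X x) = 0}
  add_mem' {u v} hu hv := by simp_all
  zero_mem' := by simp
  smul_mem' c u hu := by simp_all

/-- `(M,h)` has light-like hypersurface curvature: `R(u,v)` maps `Ξ_x^⊥` to `Ξ_x` for all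
`u, v ∈ Ξ_x^⊥`. The curvature tensor `R(u,v)w` at `x` is evaluated on vector fields `U`, `V`, `W`
that are smooth near `x` and have the values `u`, `v`, `w` at `x`. -/
def HasLightlikeHypersurfaceCurvature : Prop :=
  ∀ (x : M) (U V W : Π x : M, TangentSpace I x),
    CMDiffAt ∞ (T% U) x → CMDiffAt ∞ (T% V) x → CMDiffAt ∞ (T% W) x →
    U x ∈ h.perp X x → V x ∈ h.perp X x → W x ∈ h.perp X x →
    h.leviCivita.curvature U V W x ∈ h.line X x

/-- The fibre `S_x = Ξ_x^⊥ / Ξ_x` of the screen bundle. -/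
abbrev Screen (x : M) : Type _ := h.perp X x ⧸ (h.line X x).submoduleOf (h.perp X x)

end LorentzianMetric
end General

section Hypersurface

variable {n : ℕ} {M : Type u} [TopologicalSpace M]
  [ChartedSpace (EuclideanSpace ℝ (Fin (n + 2))) M] [IsManifold (𝓡 (n + 2)) ∞ M]

/-- A light-like hypersurface `N` of `M` defined by `X`: a connected, injectively immersed smooth
manifold of codimension one whose tangent spaces are the spaces `Ξ^⊥`, that is, a connected
integral manifold of the distribution `Ξ^⊥`. The leaves of the foliation are the maximal ones. The
universe of `carrier` is no restriction, since `N` is in bijection with a subset of `M`. -/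
structure LightlikeHypersurface (h : LorentzianMetric (𝓡 (n + 2)) M)
    (X : Π x : M, TangentSpace (𝓡 (n + 2)) x) where
  carrier : Type u
  [topologicalSpace : TopologicalSpace carrier]
  [chartedSpace : ChartedSpace (EuclideanSpace ℝ (Fin (n + 1))) carrier]
  [isManifold : IsManifold (𝓡 (n + 1)) ∞ carrier]
  [connectedSpace : ConnectedSpace carrier]
  /-- the inclusion into `M` -/
  incl : carrier → M
  injective : Function.Injective incl
  contMDiff : ContMDiff (𝓡 (n + 1)) (𝓡 (n + 2)) ∞ incl
  immersion (q : carrier) : Function.Injective (mfderiv (𝓡 (n + 1)) (𝓡 (n + 2)) incl q)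
  tangent (q : carrier) :
    (mfderiv (𝓡 (n + 1)) (𝓡 (n + 2)) incl q).range = h.perp X (incl q)

namespace LightlikeHypersurface

attribute [instance] topologicalSpace chartedSpace isManifold connectedSpace

variable {h : LorentzianMetric (𝓡 (n + 2)) M} {X : Π x : M, TangentSpace (𝓡 (n + 2)) x}
  (N : LightlikeHypersurface h X)

/-- The differential of the inclusion, as an isomorphism `T_q N ≃ Ξ^⊥`. -/
def tangentEquiv (q : N.carrier) :
    TangentSpace (𝓡 (n + 1)) q ≃ₗ[ℝ] h.perp X (N.incl q) :=
  (LinearEquiv.ofInjective (mfderiv (𝓡 (n + 1)) (𝓡 (n + 2)) N.incl q).toLinearMap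
    (N.immersion q)).trans (LinearEquiv.ofEq _ _ (N.tangent q))

/-- The class `[v] ∈ Ξ^⊥ / Ξ` of a vector `v ∈ T_q N`. -/
def toScreen (q : N.carrier) :
    TangentSpace (𝓡 (n + 1)) q →ₗ[ℝ] h.Screen X (N.incl q) :=
  ((h.line X (N.incl q)).submoduleOf (h.perp X (N.incl q))).mkQ ∘ₗ (N.tangentEquiv q).toLinearMap

/-- The Levi-Civita derivative `∇_u W ∈ T_q M` in the direction `u ∈ T_q N` of a vector field `W`
of `M` along `N`. If `w` denotes the components of `W` in the coordinate frame around `q`, it is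
the sum of the derivative of `w` in the direction `u` and of the derivative of the vector field
on `M` with constant components `w(q)` in that frame. -/
def covAlong (W : Π q : N.carrier, TangentSpace (𝓡 (n + 2)) (N.incl q)) (q : N.carrier)
    (u : TangentSpace (𝓡 (n + 1)) q) : TangentSpace (𝓡 (n + 2)) (N.incl q) :=
  let t := trivializationAt (EuclideanSpace ℝ (Fin (n + 2)))
    (TangentSpace (𝓡 (n + 2)) : M → Type _) (N.incl q)
  t.symm (N.incl q) (mvfderiv (𝓡 (n + 1)) (fun q' ↦ (t ⟨N.incl q', W q'⟩).2) q u)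
    + h.leviCivita (extend (EuclideanSpace ℝ (Fin (n + 2))) (W q)) (N.incl q)
      (mfderiv (𝓡 (n + 1)) (𝓡 (n + 2)) N.incl q u)

/-- The induced connection on `N`: the tangent vector of `N` that is mapped to `∇_u V` by the
differential of the inclusion. (It exists for differentiable `V`, since `Ξ^⊥` is parallel if `X` is
recurrent, and it is unique.) -/
def inducedCov (V : Π q : N.carrier, TangentSpace (𝓡 (n + 1)) q) (q : N.carrier)
    (u : TangentSpace (𝓡 (n + 1)) q) : TangentSpace (𝓡 (n + 1)) q :=
  Function.invFun (mfderiv (𝓡 (n + 1)) (𝓡 (n + 2)) N.incl q)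
    (N.covAlong (fun q' ↦ mfderiv (𝓡 (n + 1)) (𝓡 (n + 2)) N.incl q' (V q')) q u)

/-- `V` is a vector field on `N` representing the section `s` of the restricted screen bundle. -/
def Represents (V : Π q : N.carrier, TangentSpace (𝓡 (n + 1)) q)
    (s : Π q : N.carrier, h.Screen X (N.incl q)) : Prop :=
  ∀ q, N.toScreen q (V q) = s q

/-- Smoothness at `q` of a section of the restricted screen bundle. -/
def IsSmoothSectionAt (s : Π q : N.carrier, h.Screen X (N.incl q)) (q : N.carrier) : Prop :=
  ∃ V : Π q : N.carrier, TangentSpace (𝓡 (n + 1)) q,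
    ContMDiffAt (𝓡 (n + 1)) (𝓡 (n + 1)).tangent ∞ (T% V) q ∧ N.Represents V s

open scoped Classical in
/-- The connection on the restricted screen bundle, `∇^S_u [V] = [∇_u V]`, for any vector field `V`
on `N` that is differentiable at `q` (the value is independent of `V` if `X` is recurrent; it is
zero, by convention, for a section that is not differentiable at `q`). -/
def screenCov (s : Π q : N.carrier, h.Screen X (N.incl q)) (q : N.carrier)
    (u : TangentSpace (𝓡 (n + 1)) q) : h.Screen X (N.incl q) :=
  if hs : ∃ V : Π q : N.carrier, TangentSpace (𝓡 (n + 1)) q,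
      MDifferentiableAt (𝓡 (n + 1)) (𝓡 (n + 1)).tangent (T% V) q ∧ N.Represents V s then
    N.toScreen q (N.inducedCov hs.choose q u)
  else 0

/-- The curvature `R^S(U,V)s = ∇^S_U ∇^S_V s - ∇^S_V ∇^S_U s - ∇^S_{[U,V]} s`. -/
def screenCurvature (U V : Π q : N.carrier, TangentSpace (𝓡 (n + 1)) q)
    (s : Π q : N.carrier, h.Screen X (N.incl q)) (q : N.carrier) : h.Screen X (N.incl q) :=
  N.screenCov (fun q' ↦ N.screenCov s q' (V q')) q (U q)
    - N.screenCov (fun q' ↦ N.screenCov s q' (U q')) q (V q)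
    - N.screenCov s q (mlieBracket (𝓡 (n + 1)) U V q)

/-- The connection on the restricted screen bundle over `N` is flat: its curvature vanishes. -/
def IsScreenFlat : Prop :=
  ∀ (q : N.carrier) (U V : Π q : N.carrier, TangentSpace (𝓡 (n + 1)) q)
    (s : Π q : N.carrier, h.Screen X (N.incl q)),
    ContMDiffAt (𝓡 (n + 1)) (𝓡 (n + 1)).tangent ∞ (T% U) q →
    ContMDiffAt (𝓡 (n + 1)) (𝓡 (n + 1)).tangent ∞ (T% V) q →
    N.IsSmoothSectionAt s q →
    N.screenCurvature U V s q = 0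

end LightlikeHypersurface

end Hypersurface

end

noncomputable section

set_option linter.unusedSectionVars false

section MayerLie

open Metric Set Filter NNReal

/-- Picard–Lindelöf, with the solution staying in the ball. -/
lemma IsPicardLindelof.exists_solution_mem_closedBall {E : Type*} [NormedAddCommGroup E]
    [NormedSpace ℝ E] [CompleteSpace E] {f : ℝ → E → E} {tmin tmax : ℝ} {t₀ : Icc tmin tmax}
    {x₀ : E} {a L K : ℝ≥0} (hf : IsPicardLindelof f t₀ x₀ a 0 L K) :
    ∃ α : ℝ → E, α t₀ = x₀ ∧ (∀ t, α t ∈ closedBall x₀ a) ∧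
      ∀ t ∈ Icc tmin tmax, HasDerivWithinAt α (f t (α t)) (Icc tmin tmax) t := by
  obtain ⟨α, hα⟩ := ODE.FunSpace.exists_isFixedPt_next hf (mem_closedBall_self le_rfl)
  refine ⟨α.compProj, by rw [ODE.FunSpace.compProj_val, ← hα, ODE.FunSpace.next_apply₀],
    fun t ↦ α.compProj_mem_closedBall hf.mul_max_le, fun t ht ↦ ?_⟩
  apply ODE.hasDerivWithinAt_picard_Icc t₀.2 hf.continuousOn_uncurry
    α.continuous_compProj.continuousOn (fun _ ht' ↦ α.compProj_mem_closedBall hf.mul_max_le)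
    x₀ ht |>.congr_of_mem _ ht
  intro t' ht'
  nth_rw 1 [← hα]
  rw [ODE.FunSpace.compProj_of_mem ht', ODE.FunSpace.next_apply]

variable {G Z : Type*} [NormedAddCommGroup G] [NormedSpace ℝ G]
  [NormedAddCommGroup Z] [NormedSpace ℝ Z]

lemma gronwallBound_zero_eq_mul (K ε x : ℝ) :
    gronwallBound 0 K ε x = ε * gronwallBound 0 K 1 x := by
  unfold gronwallBound
  split_ifs <;> ring

/-- A Taylor estimate of second order for a map with Lipschitz derivative. -/
lemma norm_sub_sub_fderiv_le {E F : Type*} [NormedAddCommGroup E] [NormedSpace ℝ E]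
    [NormedAddCommGroup F] [NormedSpace ℝ F] {f : E → F} {s : Set E} {K : ℝ≥0} (hs : Convex ℝ s)
    (hd : ∀ x ∈ s, DifferentiableAt ℝ f x) (hL : LipschitzOnWith K (fderiv ℝ f) s)
    {x y : E} (hx : x ∈ s) (hy : y ∈ s) :
    ‖f y - f x - fderiv ℝ f x (y - x)‖ ≤ K * ‖y - x‖ * ‖y - x‖ := by
  have hsub : segment ℝ x y ⊆ s := hs.segment_subset hx hy
  refine (convex_segment x y).norm_image_sub_le_of_norm_hasFDerivWithin_le'
    (f' := fderiv ℝ f) (fun z hz ↦ (hd z (hsub hz)).hasFDerivAt.hasFDerivWithinAt)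
    (fun z hz ↦ ?_) (left_mem_segment ℝ x y) (right_mem_segment ℝ x y)
  refine (hL.norm_sub_le (hsub hz) hx).trans ?_
  gcongr
  rw [← dist_eq_norm, ← dist_eq_norm]
  obtain ⟨t, ht, rfl⟩ := segment_eq_image_lineMap ℝ x y ▸ hz
  rw [dist_lineMap_left, Real.norm_of_nonneg ht.1, dist_comm y x]
  exact mul_le_of_le_one_left dist_nonneg ht.2

/-- The local data needed to solve `Dg(y) = a(y, g(y))`. -/
structure TotalDifferentialData (a : G × Z → G →L[ℝ] Z) (ε : ℝ) (C K K' : ℝ≥0) : Prop where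
  pos : 0 < ε
  diff : ∀ p ∈ ball (0 : G × Z) ε, DifferentiableAt ℝ a p
  bound : ∀ p ∈ ball (0 : G × Z) ε, ‖a p‖ ≤ C
  lip : LipschitzOnWith K a (ball (0 : G × Z) ε)
  lip' : LipschitzOnWith K' (fderiv ℝ a) (ball (0 : G × Z) ε)
  integrable : ∀ p ∈ ball (0 : G × Z) ε, ∀ u v,
    fderiv ℝ a p (u, a p u) v = fderiv ℝ a p (v, a p v) u

lemma exists_totalDifferentialData {a : G × Z → G →L[ℝ] Z} (ha : ContDiffAt ℝ 2 a 0)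
    (hint : ∀ᶠ p in 𝓝 (0 : G × Z), ∀ u v,
      fderiv ℝ a p (u, a p u) v = fderiv ℝ a p (v, a p v) u) :
    ∃ ε C K K', TotalDifferentialData a ε C K K' := by
  obtain ⟨K, s, hs, hK⟩ := (ha.of_le (by norm_num)).exists_lipschitzOnWith
  obtain ⟨K', s', hs', hK'⟩ := (ha.fderiv_right (m := 1) (by norm_num)).exists_lipschitzOnWith
  have hd : ∀ᶠ p in 𝓝 (0 : G × Z), DifferentiableAt ℝ a p :=
    ((ha.eventually (by simp)).mono fun p hp ↦ hp.differentiableAt (by simp))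
  have hb : ∀ᶠ p in 𝓝 (0 : G × Z), ‖a p‖ < ‖a 0‖ + 1 :=
    ha.continuousAt.norm.eventually_lt continuousAt_const (by simp)
  obtain ⟨ε, hε, h⟩ := Metric.eventually_nhds_iff_ball.1
    (((hint.and hd).and hb).and ((eventually_mem_set.2 hs).and (eventually_mem_set.2 hs')))
  exact ⟨ε, ‖a 0‖₊ + 1, K, K', hε, fun p hp ↦ (h p hp).1.1.2, fun p hp ↦ by
    simpa using (h p hp).1.2.le, hK.mono fun p hp ↦ (h p hp).2.1,
    hK'.mono fun p hp ↦ (h p hp).2.2, fun p hp ↦ (h p hp).1.1.1⟩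

namespace TotalDifferentialData

variable {a : G × Z → G →L[ℝ] Z} {ε : ℝ} {C K K' : ℝ≥0}

lemma mem_ball_of {ε : ℝ} {y : G} {z : Z} (hy : ‖y‖ < ε) (hz : ‖z‖ < ε) :
    (y, z) ∈ ball (0 : G × Z) ε := by
  simp [hy, hz]

lemma norm_smul_le_of_mem {t : ℝ} (ht : t ∈ Icc (0 : ℝ) 1) (y : G) : ‖t • y‖ ≤ ‖y‖ := by
  rw [norm_smul, Real.norm_of_nonneg ht.1]
  exact mul_le_of_le_one_left (norm_nonneg _) ht.2

lemma lipschitz_ray (D : TotalDifferentialData a ε C K K') {y : G} {t : ℝ}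
    (hy : ‖y‖ < ε) (ht : t ∈ Icc (0 : ℝ) 1) :
    LipschitzOnWith (K * ‖y‖₊) (fun z ↦ a (t • y, z) y) (ball 0 ε) := by
  refine LipschitzOnWith.of_dist_le_mul fun z hz z' hz' ↦ ?_
  rw [dist_eq_norm, ← sub_apply]
  have h1 : ‖t • y‖ < ε := (norm_smul_le_of_mem ht y).trans_lt hy
  have := D.lip.norm_sub_le (mem_ball_of h1 (by simpa using hz))
    (mem_ball_of h1 (by simpa using hz'))
  calc _ ≤ ‖a (t • y, z) - a (t • y, z')‖ * ‖y‖ := ContinuousLinearMap.le_opNorm _ _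
    _ ≤ (K * ‖(t • y, z) - (t • y, z')‖) * ‖y‖ := by gcongr
    _ = _ := by
      simp [dist_eq_norm, Prod.norm_def]
      ring

lemma exists_ray_solution [CompleteSpace Z] (D : TotalDifferentialData a ε C K K') {y : G}
    (hy : ‖y‖ < ε) (hy' : C * ‖y‖ < ε) :
    ∃ z : ℝ → Z, z 0 = 0 ∧ (∀ t, ‖z t‖ ≤ C * ‖y‖) ∧
      ∀ t ∈ Icc (0 : ℝ) 1, HasDerivWithinAt z (a (t • y, z t) y) (Icc 0 1) t := by
  have hsub : closedBall (0 : Z) (C * ‖y‖₊ : ℝ≥0) ⊆ ball 0 ε :=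
    closedBall_subset_ball (by simpa using hy')
  have hPL : IsPicardLindelof (fun t z ↦ a (t • y, z) y) (tmin := 0) (tmax := 1)
      ⟨0, by simp⟩ 0 (C * ‖y‖₊) 0 (C * ‖y‖₊) (K * ‖y‖₊) :=
    { lipschitzOnWith := fun t ht ↦ (D.lipschitz_ray hy ht).mono hsub
      continuousOn := fun z hz t ht ↦ by
        have hm : (t • y, z) ∈ ball (0 : G × Z) ε :=
          mem_ball_of ((norm_smul_le_of_mem ht y).trans_lt hy) (by simpa using hsub hz)
        have h1 : ContinuousAt (fun t : ℝ ↦ a (t • y, z)) t :=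
          ContinuousAt.comp (f := fun t : ℝ ↦ (t • y, z)) (D.diff _ hm).continuousAt
            (by fun_prop)
        exact (h1.clm_apply continuousAt_const).continuousWithinAt
      norm_le := fun t ht z hz ↦ by
        have hm : (t • y, z) ∈ ball (0 : G × Z) ε :=
          mem_ball_of ((norm_smul_le_of_mem ht y).trans_lt hy) (by simpa using hsub hz)
        refine ((a (t • y, z)).le_opNorm y).trans ?_
        push_cast
        gcongr
        exact D.bound _ hm
      mul_max_le := by simp }
  obtain ⟨z, h0, h1, h2⟩ := hPL.exists_solution_mem_closedBall
  exact ⟨z, h0, fun t ↦ by simpa using h1 t, h2⟩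

/-- The comparison of the solutions along the rays through `y` and `y + v`. -/
lemma norm_sub_ray_le (D : TotalDifferentialData a ε C K K') {y v : G} {r : ℝ}
    (hr : r ≤ ε) (hr' : 3 * C * r < ε)
    (hy : ‖y‖ < r) (hyv : ‖y + v‖ < r) {z w : ℝ → Z} (hz0 : z 0 = 0) (hw0 : w 0 = 0)
    (hz : ∀ t, ‖z t‖ ≤ C * ‖y‖) (hw : ∀ t, ‖w t‖ ≤ C * ‖y + v‖)
    (hz' : ∀ t ∈ Icc (0 : ℝ) 1, HasDerivWithinAt z (a (t • y, z t) y) (Icc 0 1) t)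
    (hw' : ∀ t ∈ Icc (0 : ℝ) 1, HasDerivWithinAt w (a (t • (y + v), w t) (y + v)) (Icc 0 1) t) :
    ‖w 1 - (z 1 + a (y, z 1) v)‖ ≤
      (K' * (1 + C) ^ 2 * r + K * (1 + C)) * ‖v‖ ^ 2 * gronwallBound 0 (K * r) 1 1 := by
  have hr0 : 0 ≤ r := (norm_nonneg y).trans hy.le
  have hC : (0 : ℝ) ≤ C := C.2
  have hv : ‖v‖ ≤ 2 * r := by
    have : v = (y + v) - y := by abel
    rw [this]; exact (norm_sub_le _ _).trans (by linarith)
  have hp : ∀ t ∈ Icc (0 : ℝ) 1, (t • y, z t) ∈ ball (0 : G × Z) ε := fun t ht ↦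
    mem_ball_of ((norm_smul_le_of_mem ht y).trans_lt (hy.trans_le hr))
      ((hz t).trans_lt (by nlinarith [norm_nonneg y]))
  set q : ℝ → Z := fun t ↦ z t + t • a (t • y, z t) v with hq
  have hqn : ∀ t ∈ Icc (0 : ℝ) 1, ‖q t‖ < ε := fun t ht ↦ by
    have h1 : ‖t • a (t • y, z t) v‖ ≤ C * (2 * r) :=
      (norm_smul_le_of_mem ht _).trans (((a (t • y, z t)).le_opNorm v).trans
        (mul_le_mul (D.bound _ (hp t ht)) hv (norm_nonneg _) hC))
    have h2 := hz t
    have h3 := norm_add_le (z t) (t • a (t • y, z t) v)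
    have h4 : C * ‖y‖ ≤ C * r := by gcongr
    simp only [hq]
    linarith
  have hp' : ∀ t ∈ Icc (0 : ℝ) 1, (t • (y + v), q t) ∈ ball (0 : G × Z) ε := fun t ht ↦
    mem_ball_of ((norm_smul_le_of_mem ht _).trans_lt (hyv.trans_le hr)) (hqn t ht)
  -- the derivative of `q`
  have hq' : ∀ t ∈ Icc (0 : ℝ) 1, HasDerivWithinAt q (a (t • y, z t) y +
      (t • fderiv ℝ a (t • y, z t) (y, a (t • y, z t) y) v + (1 : ℝ) • a (t • y, z t) v))
      (Icc 0 1) t := fun t ht ↦ by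
    have h1 : HasDerivWithinAt (fun t : ℝ ↦ (t • y, z t)) ((1 : ℝ) • y, a (t • y, z t) y)
        (Icc 0 1) t := ((hasDerivWithinAt_id t _).smul_const y).prodMk (hz' t ht)
    have h2 : HasDerivWithinAt (fun t : ℝ ↦ a (t • y, z t)) _ (Icc 0 1) t :=
      (D.diff _ (hp t ht)).hasFDerivAt.comp_hasDerivWithinAt t h1
    rw [one_smul] at h2
    have h3 := h2.clm_apply (hasDerivWithinAt_const t (Icc 0 1) v)
    simp only [map_zero, add_zero] at h3
    exact (hz' t ht).add ((hasDerivWithinAt_id t _).smul h3)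
  have hK : (0 : ℝ) ≤ K := K.2
  have key := dist_le_of_approx_trajectories_ODE_of_mem (v := fun t x ↦ a (t • (y + v), x) (y + v))
    (s := fun _ ↦ ball 0 ε) (K := K * r.toNNReal) (a := 0) (b := 1) (f := q) (g := w) (δ := 0)
    (εf := (K' * (1 + C) ^ 2 * r + K * (1 + C)) * ‖v‖ ^ 2) (εg := 0)
    (fun t ht ↦ (D.lipschitz_ray (hyv.trans_le hr) (Ico_subset_Icc_self ht)).weaken
      (mul_le_mul_right (NNReal.le_toNNReal_of_coe_le hyv.le) _))
    (fun t ht ↦ (hq' t ht).continuousWithinAt)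
    (fun t ht ↦ (hq' t (Ico_subset_Icc_self ht)).mono_of_mem_nhdsWithin
      (Icc_mem_nhdsGE_of_mem ht)) ?_
    (fun t ht ↦ by simpa using hqn t (Ico_subset_Icc_self ht))
    (fun t ht ↦ (hw' t ht).continuousWithinAt)
    (fun t ht ↦ (hw' t (Ico_subset_Icc_self ht)).mono_of_mem_nhdsWithin
      (Icc_mem_nhdsGE_of_mem ht))
    (fun t ht ↦ by simp)
    (fun t ht ↦ by
      simp only [mem_ball_zero_iff]
      refine (hw t).trans_lt ?_
      have : C * ‖y + v‖ ≤ C * r := by gcongr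
      nlinarith)
    (by simp [hq, hz0, hw0]) 1 (by simp)
  · rw [dist_eq_norm, norm_sub_rev, add_zero, gronwallBound_zero_eq_mul] at key
    rw [NNReal.coe_mul, Real.coe_toNNReal r hr0] at key
    simpa [hq] using key
  · intro t ht
    have ht' := Ico_subset_Icc_self ht
    set p : G × Z := (t • y, z t) with hpdef
    set d : G × Z := (v, a p v) with hd
    have hdn : ‖d‖ ≤ (1 + C) * ‖v‖ := by
      rw [hd, Prod.norm_def]
      refine max_le (by nlinarith [norm_nonneg v, mul_nonneg hC (norm_nonneg v)]) ?_
      refine ((a p).le_opNorm v).trans ?_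
      have := D.bound _ (hp t ht')
      nlinarith [norm_nonneg v, mul_le_mul_of_nonneg_right this (norm_nonneg v)]
    have hpd : (t • (y + v), q t) = p + t • d := by
      simp [hpdef, hd, hq]
    have htay := norm_sub_sub_fderiv_le (convex_ball _ _) D.diff D.lip' (hp t ht') (hp' t ht')
    rw [hpd, add_sub_cancel_left] at htay
    have htd : ‖t • d‖ ≤ (1 + C) * ‖v‖ := (norm_smul_le_of_mem ht' d).trans hdn
    have hDa : ‖fderiv ℝ a p‖ ≤ K :=
      norm_fderiv_le_of_lipschitzOn ℝ (isOpen_ball.mem_nhds (hp t ht')) D.lip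
    rw [D.integrable _ (hp t ht') y v, dist_eq_norm, hpd]
    have e : a p y + (t • fderiv ℝ a p (v, a p v) y + (1 : ℝ) • a p v) - a (p + t • d) (y + v) =
        - (a (p + t • d) - a p - fderiv ℝ a p (t • d)) (y + v) - fderiv ℝ a p (t • d) v := by
      have e1 : a p v = d.2 := rfl
      rw [map_smul, ← hd]
      simp only [sub_apply, smul_apply, map_add, one_smul]
      abel
    rw [e]
    have b1 : ‖(a (p + t • d) - a p - fderiv ℝ a p (t • d)) (y + v)‖ ≤
        (K' * ((1 + C) * ‖v‖) * ((1 + C) * ‖v‖)) * r := by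
      refine (ContinuousLinearMap.le_opNorm _ _).trans ?_
      refine mul_le_mul (htay.trans ?_) hyv.le (norm_nonneg _) (by positivity)
      gcongr
    have b2 : ‖fderiv ℝ a p (t • d) v‖ ≤ (K * ((1 + C) * ‖v‖)) * ‖v‖ := by
      refine (ContinuousLinearMap.le_opNorm _ _).trans ?_
      gcongr
      refine (ContinuousLinearMap.le_opNorm _ _).trans ?_
      gcongr
    refine (norm_sub_le _ _).trans ?_
    rw [norm_neg]
    linarith

/-- Local solvability of an integrable total differential equation `Dg(y) = a(y, g(y))`. -/
theorem exists_solution [CompleteSpace Z] (D : TotalDifferentialData a ε C K K') :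
    ∃ g : G → Z, g 0 = 0 ∧ ∀ᶠ y in 𝓝 0, HasFDerivAt g (a (y, g y)) y := by
  have hε := D.pos
  obtain ⟨r, hr0, hr, hr'⟩ : ∃ r : ℝ, 0 < r ∧ r ≤ ε ∧ 3 * C * r < ε := by
    refine ⟨min ε (ε / (3 * C + 1)), by positivity, min_le_left _ _, ?_⟩
    calc 3 * C * min ε (ε / (3 * C + 1)) ≤ 3 * C * (ε / (3 * C + 1)) := by
          gcongr; exact min_le_right _ _
      _ < ε := by
          rw [← mul_div_assoc, div_lt_iff₀ (by positivity)]
          nlinarith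
  have hex : ∀ y : G, ∃ z : ℝ → Z, ‖y‖ < r → (z 0 = 0 ∧ (∀ t, ‖z t‖ ≤ C * ‖y‖) ∧
      ∀ t ∈ Icc (0 : ℝ) 1, HasDerivWithinAt z (a (t • y, z t) y) (Icc 0 1) t) := fun y ↦ by
    by_cases hy : ‖y‖ < r
    · obtain ⟨z, hz⟩ := D.exists_ray_solution (y := y) (hy.trans_le hr) (by
        have : C * ‖y‖ ≤ C * r := by gcongr
        have : 0 ≤ C * r := by positivity
        linarith)
      exact ⟨z, fun _ ↦ hz⟩
    · exact ⟨fun _ ↦ 0, fun h ↦ absurd h hy⟩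
  choose z hz using hex
  refine ⟨fun y ↦ z y 1, ?_, ?_⟩
  · simpa using (hz 0 (by simpa using hr0)).2.1 1
  · filter_upwards [isOpen_ball.mem_nhds (mem_ball_self (x := (0 : G)) hr0)] with y hy
    rw [mem_ball_zero_iff] at hy
    rw [hasFDerivAt_iff_isLittleO_nhds_zero]
    refine Asymptotics.IsBigO.trans_isLittleO (g := fun v : G ↦ ‖v‖ ^ 2) ?_ ?_
    · refine Asymptotics.IsBigO.of_bound ((K' * (1 + C) ^ 2 * r + K * (1 + C)) *
        gronwallBound 0 (K * r) 1 1) ?_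
      have hev : ∀ᶠ v in 𝓝 (0 : G), ‖y + v‖ < r :=
        ContinuousAt.eventually_lt (by fun_prop) continuousAt_const (by simpa using hy)
      filter_upwards [hev] with v hv
      have := D.norm_sub_ray_le hr hr' hy hv (hz y hy).1 (hz _ hv).1 (hz y hy).2.1 (hz _ hv).2.1
        (hz y hy).2.2 (hz _ hv).2.2
      rw [sub_sub, Real.norm_of_nonneg (by positivity)]
      linarith
    · exact Asymptotics.isLittleO_norm_pow_id one_lt_two

end TotalDifferentialData

end MayerLie

section IntegralHypersurface

open Metric Set Filter

variable {G F : Type*} [NormedAddCommGroup G] [NormedSpace ℝ G]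
  [NormedAddCommGroup F] [NormedSpace ℝ F]

lemma contDiffOn_of_hasFDerivAt_comp {a : G × ℝ → G →L[ℝ] ℝ} {U : Set (G × ℝ)} {B : Set G}
    (ha : ContDiffOn ℝ ∞ a U) (hB : IsOpen B) {g : G → ℝ} (hgU : ∀ y ∈ B, (y, g y) ∈ U)
    (hg : ∀ y ∈ B, HasFDerivAt g (a (y, g y)) y) : ContDiffOn ℝ ∞ g B := by
  rw [contDiffOn_infty]
  intro k
  induction k with
  | zero =>
    rw [Nat.cast_zero, contDiffOn_zero]
    exact fun y hy ↦ (hg y hy).continuousAt.continuousWithinAt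
  | succ k ih =>
    rw [Nat.cast_succ, contDiffOn_succ_iff_fderiv_of_isOpen hB]
    refine ⟨fun y hy ↦ (hg y hy).differentiableAt.differentiableWithinAt, by simp, ?_⟩
    have h1 : ContDiffOn ℝ k (fun y ↦ a (y, g y)) B :=
      ContDiffOn.comp (t := U) (g := a) (f := fun y ↦ (y, g y))
        (ha.of_le (by exact_mod_cast le_top)) (contDiffOn_id.prodMk ih) hgU
    exact h1.congr fun y hy ↦ (hg y hy).fderiv

/-- The slope of the graph of an integral hypersurface of `ker ξ` over the hyperplane `range j`,
in the direction `e`, at the point `z₀ + T (y, s)`. -/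
def graphSlope (ξ : F → F →L[ℝ] ℝ) (z₀ e : F) (j : G →L[ℝ] F) (T : G × ℝ →L[ℝ] F) (p : G × ℝ) :
    G →L[ℝ] ℝ :=
  -((ξ (z₀ + T p) e)⁻¹ • (ξ (z₀ + T p)).comp j)

/-- The `1`-form `ξ` with `dξ = 0` on `ker ξ` has an integral hypersurface through any point where
it does not vanish. -/
theorem exists_integral_hypersurface [FiniteDimensional ℝ F] [FiniteDimensional ℝ G]
    (hdim : finrank ℝ F = finrank ℝ G + 1) {ξ : F → F →L[ℝ] ℝ} {Ω : Set F} (hΩ : IsOpen Ω)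
    (hξ : ContDiffOn ℝ ∞ ξ Ω) {z₀ : F} (hz₀ : z₀ ∈ Ω) (hne : ξ z₀ ≠ 0)
    (hint : ∀ z ∈ Ω, ∀ u v, ξ z u = 0 → ξ z v = 0 → fderiv ℝ ξ z u v = fderiv ℝ ξ z v u) :
    ∃ r > 0, ∃ σ : G → F, σ 0 = z₀ ∧ ContDiffOn ℝ ∞ σ (ball 0 r) ∧ MapsTo σ (ball 0 r) Ω ∧
      Function.Injective σ ∧ ∀ y ∈ ball (0 : G) r, Function.Injective (fderiv ℝ σ y) ∧
        ∀ v, ξ (σ y) (fderiv ℝ σ y v) = 0 := by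
  obtain ⟨e, he⟩ : ∃ e, ξ z₀ e ≠ 0 := by
    by_contra! h
    exact hne (ContinuousLinearMap.ext h)
  have hfin : finrank ℝ G = finrank ℝ (ξ z₀).ker := by
    have h1 := (ξ z₀).toLinearMap.finrank_range_add_finrank_ker
    have h2 : finrank ℝ (ξ z₀).toLinearMap.range = 1 := by
      rw [LinearMap.range_eq_top.2 (LinearMap.surjective_of_ne_zero ?_), finrank_top, finrank_self]
      exact fun h ↦ he (congrArg (fun f : F →ₗ[ℝ] ℝ ↦ f e) h)
    have h3 : finrank ℝ (ξ z₀).ker = finrank ℝ (ξ z₀).toLinearMap.ker := rfl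
    omega
  let j : G →L[ℝ] F := LinearMap.toContinuousLinearMap
    ((ξ z₀).ker.subtype ∘ₗ (LinearEquiv.ofFinrankEq G (ξ z₀).ker hfin).toLinearMap)
  have hj : Function.Injective j :=
    (Subtype.val_injective.comp (LinearEquiv.ofFinrankEq G (ξ z₀).ker hfin).injective :)
  have hj0 : ∀ y, ξ z₀ (j y) = 0 := fun y ↦ (LinearEquiv.ofFinrankEq G (ξ z₀).ker hfin y).2
  clear_value j
  let T : G × ℝ →L[ℝ] F := j.comp (.fst ℝ G ℝ) + (ContinuousLinearMap.snd ℝ G ℝ).smulRight e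
  have hT : ∀ y s, T (y, s) = j y + s • e := fun y s ↦ rfl
  have hTinj : Function.Injective T := by
    rw [injective_iff_map_eq_zero]
    rintro ⟨y, s⟩ h
    have h1 := congrArg (ξ z₀) h
    rw [hT] at h h1
    have hs : s = 0 := by simpa [hj0, he] using h1
    rw [hs, zero_smul, add_zero, ← map_zero j] at h
    rw [hs, hj h]; rfl
  clear_value T
  let a := graphSlope ξ z₀ e j T
  let U : Set (G × ℝ) := {p | z₀ + T p ∈ Ω ∩ (fun z ↦ ξ z e) ⁻¹' {0}ᶜ}
  have hcont : ContinuousOn (fun z ↦ ξ z e) Ω := hξ.continuousOn.clm_apply continuousOn_const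
  have hU : IsOpen U :=
    (hcont.isOpen_inter_preimage hΩ isOpen_compl_singleton).preimage (by fun_prop)
  have h0U : (0 : G × ℝ) ∈ U := by simp [U, hz₀, he]
  have hP : ContDiff ℝ ∞ fun p ↦ z₀ + T p := contDiff_const.add T.contDiff
  have hξP : ContDiffOn ℝ ∞ (fun p ↦ ξ (z₀ + T p)) U := hξ.comp hP.contDiffOn fun p hp ↦ hp.1
  have ha : ContDiffOn ℝ ∞ a U :=
    (((hξP.clm_apply contDiffOn_const).inv fun p hp ↦ hp.2).smul
      (hξP.clm_comp contDiffOn_const)).neg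
  have hker : ∀ p ∈ U, ∀ v, ξ (z₀ + T p) (T (v, a p v)) = 0 := fun p hp v ↦ by
    have : ξ (z₀ + T p) e ≠ 0 := hp.2
    have h1 : a p v = -((ξ (z₀ + T p) e)⁻¹ * ξ (z₀ + T p) (j v)) := rfl
    rw [h1, hT v, map_add, map_smul, smul_eq_mul]
    field_simp
    ring
  have hda : ∀ p ∈ U, ∀ u v, fderiv ℝ a p u v * ξ (z₀ + T p) e =
      - fderiv ℝ ξ (z₀ + T p) (T u) (T (v, a p v)) := fun p hp u v ↦ by
    have h1 : HasFDerivAt (fun p ↦ ξ (z₀ + T p)) ((fderiv ℝ ξ (z₀ + T p)).comp T) p := by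
      refine HasFDerivAt.comp p (f := fun p ↦ z₀ + T p) (g := ξ) ?_ (T.hasFDerivAt.const_add z₀)
      exact ((hξ.contDiffAt (hΩ.mem_nhds hp.1)).differentiableAt (by simp)).hasFDerivAt
    have h2 : HasFDerivAt a (fderiv ℝ a p) p :=
      ((ha.contDiffAt (hU.mem_nhds hp)).differentiableAt (by simp)).hasFDerivAt
    have h3 : HasFDerivAt (fun p ↦ T (v, a p v)) _ p :=
      T.hasFDerivAt.comp p ((hasFDerivAt_const v p).prodMk
        (h2.clm_apply (hasFDerivAt_const v p)))
    have h4 := h1.clm_apply h3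
    have h5 : HasFDerivAt (fun p ↦ ξ (z₀ + T p) (T (v, a p v))) (0 : G × ℝ →L[ℝ] ℝ) p := by
      refine (hasFDerivAt_const (0 : ℝ) p).congr_of_eventuallyEq ?_
      exact eventually_of_mem (hU.mem_nhds hp) fun q hq ↦ hker q hq v
    have h6 := congrArg (fun f : G × ℝ →L[ℝ] ℝ ↦ f u) (h4.unique h5)
    have h7 : T (0, fderiv ℝ a p u v) = fderiv ℝ a p u v • e := by rw [hT, map_zero, zero_add]
    simp [h7] at h6
    linarith
  have hinta : ∀ p ∈ U, ∀ u v, fderiv ℝ a p (u, a p u) v = fderiv ℝ a p (v, a p v) u := by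
    intro p hp u v
    have hN : ξ (z₀ + T p) e ≠ 0 := hp.2
    apply mul_right_cancel₀ hN
    rw [hda p hp, hda p hp, hint _ hp.1 _ _ (hker p hp u) (hker p hp v)]
  obtain ⟨ε, C, K, K', D⟩ := exists_totalDifferentialData
    ((ha.contDiffAt (hU.mem_nhds h0U)).of_le (WithTop.coe_le_coe.2 (le_top : (2 : ℕ∞) ≤ ⊤)))
    (eventually_of_mem (hU.mem_nhds h0U) hinta)
  obtain ⟨g, hg0, hg⟩ := D.exists_solution
  have hgc : ContinuousAt (fun y ↦ (y, g y)) 0 :=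
    continuousAt_id.prodMk hg.self_of_nhds.continuousAt
  have hgU : ∀ᶠ y in 𝓝 0, (y, g y) ∈ U :=
    hgc.eventually_mem (by rw [hg0]; exact hU.mem_nhds h0U)
  obtain ⟨r, hr, hB⟩ := Metric.eventually_nhds_iff_ball.1 (hg.and hgU)
  have hgs : ContDiffOn ℝ ∞ g (ball 0 r) :=
    contDiffOn_of_hasFDerivAt_comp ha isOpen_ball (fun y hy ↦ (hB y hy).2) fun y hy ↦ (hB y hy).1
  have hσ' : ∀ y ∈ ball (0 : G) r, ∀ v,
      fderiv ℝ (fun y ↦ z₀ + T (y, g y)) y v = T (v, a (y, g y) v) := fun y hy v ↦ by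
    have h1 : HasFDerivAt (fun y ↦ z₀ + T (y, g y)) _ y :=
      (T.hasFDerivAt.comp y ((hasFDerivAt_id y).prodMk (hB y hy).1)).const_add z₀
    rw [h1.fderiv]
    rfl
  refine ⟨r, hr, fun y ↦ z₀ + T (y, g y), ?_, ?_, fun y hy ↦ (hB y hy).2.1, ?_, ?_⟩
  · simp only [hg0, Prod.mk_zero_zero, map_zero, add_zero]
  · exact contDiffOn_const.add (T.contDiff.comp_contDiffOn (contDiffOn_id.prodMk hgs))
  · intro y y' h
    exact congrArg Prod.fst (hTinj (add_left_cancel h))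
  · intro y hy
    refine ⟨fun v v' h ↦ ?_, fun v ↦ ?_⟩
    · rw [hσ' y hy, hσ' y hy] at h
      exact congrArg Prod.fst (hTinj h)
    · rw [hσ' y hy]
      exact hker _ (hB y hy).2 v

end IntegralHypersurface

section Bracket

open Set Filter

variable {E : Type*} [NormedAddCommGroup E] [NormedSpace ℝ E] [FiniteDimensional ℝ E]
  {H : Type*} [TopologicalSpace H] {I : ModelWithCorners ℝ E H} [I.Boundaryless]
  {M : Type*} [TopologicalSpace M] [ChartedSpace H M] [IsManifold I ∞ M]
  {F : Type*} [NormedAddCommGroup F] [NormedSpace ℝ F]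

/-- The vector field `U` read in the preferred chart at `x`. -/
def chartField (x : M) (U : Π x : M, TangentSpace I x) : E → E :=
  mpullbackWithin 𝓘(ℝ, E) I (extChartAt I x).symm U (range I)

lemma differentiableAt_chartField {x : M} {U : Π x : M, TangentSpace I x} (hU : MDiffAt (T% U) x) :
    DifferentiableAt ℝ (chartField x U) (extChartAt I x x) := by
  have : IsManifold I 2 M := IsManifold.of_le (n := ∞) (WithTop.coe_le_coe.2 le_top)
  have h := MDifferentiableWithinAt.differentiableWithinAt_mpullbackWithin_vectorField (I := I)
    (s := univ) (V := U) (x := x) hU.mdifferentiableWithinAt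
  simp only [preimage_univ, univ_inter, I.range_eq_univ] at h
  rw [chartField, I.range_eq_univ]
  exact differentiableWithinAt_univ.1 h

lemma chartField_extChartAt {x y : M} (hy : y ∈ (extChartAt I x).source)
    (U : Π x : M, TangentSpace I x) :
    chartField x U (extChartAt I x y) = mfderiv I 𝓘(ℝ, E) (extChartAt I x) y (U y) := by
  have : IsManifold I 1 M := IsManifold.of_le (n := ∞) (by simp)
  have hinv := isInvertible_mfderivWithin_extChartAt_symm (I := I) ((extChartAt I x).map_source hy)
  let A : E →L[ℝ] E := mfderivWithin 𝓘(ℝ, E) I (extChartAt I x).symm (range I) (extChartAt I x y)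
  let B : E →L[ℝ] E := mfderiv I 𝓘(ℝ, E) (extChartAt I x) y
  have h1 : A.comp B = ContinuousLinearMap.id ℝ E :=
    mfderivWithin_extChartAt_symm_comp_mfderiv_extChartAt' (I := I) hy
  have hU : ∀ z, z = y → (U z : E) = U y := by rintro z rfl; rfl
  refine (ContinuousLinearMap.IsInvertible.inverse_apply_eq (f := A) hinv).2 ?_
  refine (hU _ ((extChartAt I x).left_inv hy)).trans ?_
  exact (congrArg (fun f : E →L[ℝ] E ↦ f (U y)) h1).symm

lemma mfderiv_extChartAt_mlieBracket (x : M) (U V : Π x : M, TangentSpace I x) :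
    mfderiv I 𝓘(ℝ, E) (extChartAt I x) x (mlieBracket I U V x) =
      lieBracket ℝ (chartField x U) (chartField x V) (extChartAt I x x) := by
  have : IsManifold I 1 M := IsManifold.of_le (n := ∞) (by simp)
  have hinv := isInvertible_mfderiv_extChartAt (I := I) (mem_extChartAt_source (I := I) x)
  let B : E →L[ℝ] E := mfderiv I 𝓘(ℝ, E) (extChartAt I x) x
  have h : mlieBracket I U V x =
      B.inverse (lieBracket ℝ (chartField x U) (chartField x V) (extChartAt I x x)) := by
    rw [← mlieBracketWithin_univ, mlieBracketWithin_apply, ← lieBracketWithin_univ, preimage_univ,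
      univ_inter, chartField, chartField, I.range_eq_univ]
    rfl
  exact ((ContinuousLinearMap.IsInvertible.inverse_apply_eq (f := B) hinv).1 h.symm).symm

variable {f : M → F} {x : M}

lemma contDiffAt_comp_extChartAt_symm {n : WithTop ℕ∞} [IsManifold I n M] (hf : CMDiffAt n f x) :
    ContDiffAt ℝ n (f ∘ (extChartAt I x).symm) (extChartAt I x x) := by
  have h := (contMDiffAt_iff.1 hf).2
  rw [I.range_eq_univ] at h
  exact contDiffWithinAt_univ.1 h

lemma mvfderiv_eq_fderiv_extChartAt {y : M} (hy : y ∈ (extChartAt I x).source)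
    (hf : MDiffAt f y) (v : TangentSpace I y) :
    d% f y v = fderiv ℝ (f ∘ (extChartAt I x).symm) (extChartAt I x y)
      (mfderiv I 𝓘(ℝ, E) (extChartAt I x) y v) := by
  have : IsManifold I 1 M := IsManifold.of_le (n := ∞) (by simp)
  have hψ : MDifferentiableAt 𝓘(ℝ, E) I (extChartAt I x).symm (extChartAt I x y) := by
    have h := mdifferentiableWithinAt_extChartAt_symm (I := I) ((extChartAt I x).map_source hy)
    rwa [I.range_eq_univ, mdifferentiableWithinAt_univ] at h
  have hg : MDifferentiableAt 𝓘(ℝ, E) 𝓘(ℝ, F) (f ∘ (extChartAt I x).symm) (extChartAt I x y) :=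
    MDifferentiableAt.comp (extChartAt I x y) (I' := I)
      (by rwa [(extChartAt I x).left_inv hy]) hψ
  have hφ : MDifferentiableAt I 𝓘(ℝ, E) (extChartAt I x) y :=
    mdifferentiableAt_extChartAt (by simpa using hy)
  have he : f =ᶠ[𝓝 y] (f ∘ (extChartAt I x).symm) ∘ extChartAt I x := by
    filter_upwards [extChartAt_source_mem_nhds' (I := I) hy] with w hw
    simp only [Function.comp_apply, (extChartAt I x).left_inv hw]
  have h1 : mfderiv I 𝓘(ℝ, F) f y = _ := he.mfderiv_eq.trans (mfderiv_comp y hg hφ)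
  rw [mfderiv_eq_fderiv] at h1
  exact congrArg (fun A : E →L[ℝ] F ↦ A v) h1

/-- The derivative of `f` along a vector field, read in the preferred chart at `x`. -/
lemma eventually_mvfderiv_apply_eq (hf : CMDiffAt 2 f x) (U : Π x : M, TangentSpace I x) :
    ∀ᶠ y in 𝓝 x, d% f y (U y) = fderiv ℝ (f ∘ (extChartAt I x).symm) (extChartAt I x y)
      (chartField x U (extChartAt I x y)) := by
  have : IsManifold I 2 M := IsManifold.of_le (n := ∞) (WithTop.coe_le_coe.2 le_top)
  filter_upwards [(contMDiffAt_iff_contMDiffAt_nhds (by simp)).1 hf,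
    extChartAt_source_mem_nhds (I := I) x] with y h1 h2
  rw [chartField_extChartAt h2, mvfderiv_eq_fderiv_extChartAt h2 (h1.mdifferentiableAt two_ne_zero)]

lemma hasFDerivAt_fderiv_chartField (hf : CMDiffAt 2 f x) {U : Π x : M, TangentSpace I x}
    (hU : MDiffAt (T% U) x) :
    HasFDerivAt (fun w ↦ fderiv ℝ (f ∘ (extChartAt I x).symm) w (chartField x U w))
      (((fderiv ℝ (f ∘ (extChartAt I x).symm) (extChartAt I x x)).comp
        (fderiv ℝ (chartField x U) (extChartAt I x x))) +
      (fderiv ℝ (fderiv ℝ (f ∘ (extChartAt I x).symm)) (extChartAt I x x)).flip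
        (chartField x U (extChartAt I x x))) (extChartAt I x x) := by
  have : IsManifold I 2 M := IsManifold.of_le (n := ∞) (WithTop.coe_le_coe.2 le_top)
  have h1 := (contDiffAt_comp_extChartAt_symm hf).fderiv_right (m := 1) (by norm_num)
  exact (h1.differentiableAt one_ne_zero).hasFDerivAt.clm_apply
    (differentiableAt_chartField hU).hasFDerivAt

lemma mdifferentiableAt_mvfderiv_apply (hf : CMDiffAt 2 f x) {U : Π x : M, TangentSpace I x}
    (hU : MDiffAt (T% U) x) : MDiffAt (fun y ↦ d% f y (U y)) x := by
  have : IsManifold I 1 M := IsManifold.of_le (n := ∞) (by simp)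
  have hk := (hasFDerivAt_fderiv_chartField hf hU).differentiableAt.mdifferentiableAt
  have hφ : MDifferentiableAt I 𝓘(ℝ, E) (extChartAt I x) x :=
    mdifferentiableAt_extChartAt (mem_chart_source H x)
  exact (hk.comp x hφ).congr_of_eventuallyEq (eventually_mvfderiv_apply_eq hf U)

lemma mvfderiv_mvfderiv_apply (hf : CMDiffAt 2 f x) {U : Π x : M, TangentSpace I x}
    (hU : MDiffAt (T% U) x) (v : TangentSpace I x) :
    d% (fun y ↦ d% f y (U y)) x v =
      fderiv ℝ (fderiv ℝ (f ∘ (extChartAt I x).symm)) (extChartAt I x x)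
        (mfderiv I 𝓘(ℝ, E) (extChartAt I x) x v) (chartField x U (extChartAt I x x)) +
      fderiv ℝ (f ∘ (extChartAt I x).symm) (extChartAt I x x)
        (fderiv ℝ (chartField x U) (extChartAt I x x)
          (mfderiv I 𝓘(ℝ, E) (extChartAt I x) x v)) := by
  have : IsManifold I 1 M := IsManifold.of_le (n := ∞) (by simp)
  have hk := hasFDerivAt_fderiv_chartField hf hU
  have hφ : MDifferentiableAt I 𝓘(ℝ, E) (extChartAt I x) x :=
    mdifferentiableAt_extChartAt (mem_chart_source H x)
  have h1 : mfderiv I 𝓘(ℝ, F) (fun y ↦ d% f y (U y)) x = _ :=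
    Filter.EventuallyEq.mfderiv_eq (eventually_mvfderiv_apply_eq hf U)
  have h2 := mfderiv_comp x hk.differentiableAt.mdifferentiableAt hφ
  rw [mfderiv_eq_fderiv, hk.fderiv] at h2
  refine (congrArg (fun A : E →L[ℝ] F ↦ A v) (h1.trans h2)).trans ?_
  exact add_comm _ _

/-- The Lie bracket acts on functions as the commutator of derivations. -/
lemma mvfderiv_mlieBracket (hf : CMDiffAt 2 f x) {U V : Π x : M, TangentSpace I x}
    (hU : MDiffAt (T% U) x) (hV : MDiffAt (T% V) x) :
    d% f x (mlieBracket I U V x) =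
      d% (fun y ↦ d% f y (V y)) x (U x) - d% (fun y ↦ d% f y (U y)) x (V x) := by
  have hx := mem_extChartAt_source (I := I) x
  have : IsManifold I 2 M := IsManifold.of_le (n := ∞) (WithTop.coe_le_coe.2 le_top)
  have hsymm : IsSymmSndFDerivAt ℝ (f ∘ (extChartAt I x).symm) (extChartAt I x x) :=
    (contDiffAt_comp_extChartAt_symm hf).isSymmSndFDerivAt (by simp)
  rw [mvfderiv_mvfderiv_apply hf hU, mvfderiv_mvfderiv_apply hf hV,
    mvfderiv_eq_fderiv_extChartAt hx (hf.mdifferentiableAt two_ne_zero),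
    mfderiv_extChartAt_mlieBracket, ← chartField_extChartAt hx, ← chartField_extChartAt hx,
    hsymm, lieBracket, map_sub]
  abel

end Bracket

section LeviCivitaRegularity

open Set Filter

section
variable {E : Type*} [NormedAddCommGroup E] [NormedSpace ℝ E]
  {H : Type*} [TopologicalSpace H] {I : ModelWithCorners ℝ E H}
  {M : Type*} [TopologicalSpace M] [ChartedSpace H M]
  {G F : Type*} [NormedAddCommGroup G] [NormedSpace ℝ G] [FiniteDimensional ℝ G]
  [NormedAddCommGroup F] [NormedSpace ℝ F]

lemma ContinuousLinearMap.eq_sum_smulRightL {ι : Type*} [Fintype ι] (b : Basis ι ℝ G)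
    (A : G →L[ℝ] F) :
    A = ∑ i, ContinuousLinearMap.smulRightL ℝ G F (LinearMap.toContinuousLinearMap (b.coord i))
      (A (b i)) := by
  ext v
  conv_lhs => rw [← b.sum_repr v, map_sum]
  simp

lemma MDifferentiableAt.inverse_clm_apply [CompleteSpace G] {A : M → G →L[ℝ] F} {c : M → F} {x : M}
    (hA : MDifferentiableAt I 𝓘(ℝ, G →L[ℝ] F) A x) (hc : MDifferentiableAt I 𝓘(ℝ, F) c x)
    {e : G ≃L[ℝ] F} (he : (e : G →L[ℝ] F) = A x) :
    MDifferentiableAt I 𝓘(ℝ, G) (fun y ↦ ContinuousLinearMap.inverse (A y) (c y)) x := by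
  have hi : DifferentiableAt ℝ (fun B : G →L[ℝ] F ↦ ContinuousLinearMap.inverse B) (A x) :=
    he ▸ (contDiffAt_map_inverse (n := 1) e).differentiableAt one_ne_zero
  exact (hi.mdifferentiableAt.comp x hA).clm_apply hc

lemma MDifferentiableAt.finsetSum {ι : Type*} {s : Finset ι} {f : ι → M → F} {x : M}
    (h : ∀ i ∈ s, MDifferentiableAt I 𝓘(ℝ, F) (f i) x) :
    MDifferentiableAt I 𝓘(ℝ, F) (fun y ↦ ∑ i ∈ s, f i y) x := by
  classical
  induction s using Finset.induction_on with
  | empty => simpa using mdifferentiableAt_const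
  | insert a s ha ih =>
    simp only [Finset.sum_insert ha]
    exact (h a (by simp)).add (ih fun i hi ↦ h i (by simp [hi]))

lemma MDifferentiableAt.clm_of_apply {A : M → G →L[ℝ] F} {x : M}
    (h : ∀ v, MDifferentiableAt I 𝓘(ℝ, F) (fun y ↦ A y v) x) :
    MDifferentiableAt I 𝓘(ℝ, G →L[ℝ] F) A x := by
  have b := finBasis ℝ G
  have e : A = fun y ↦ ∑ i, ContinuousLinearMap.smulRightL ℝ G F
      (LinearMap.toContinuousLinearMap (b.coord i)) (A y (b i)) := by
    ext1 y; exact (A y).eq_sum_smulRightL b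
  rw [e]
  refine .finsetSum fun i _ ↦ ?_
  exact (ContinuousLinearMap.smulRightL ℝ G F (LinearMap.toContinuousLinearMap
    (b.coord i))).differentiableAt.mdifferentiableAt.comp x (h (b i))

lemma ContMDiffAt.clm_of_apply {n : WithTop ℕ∞} {A : M → G →L[ℝ] F} {x : M}
    (h : ∀ v, ContMDiffAt I 𝓘(ℝ, F) n (fun y ↦ A y v) x) :
    ContMDiffAt I 𝓘(ℝ, G →L[ℝ] F) n A x := by
  have b := finBasis ℝ G
  have e : A = fun y ↦ ∑ i, ContinuousLinearMap.smulRightL ℝ G F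
      (LinearMap.toContinuousLinearMap (b.coord i)) (A y (b i)) := by
    ext1 y; exact (A y).eq_sum_smulRightL b
  rw [e]
  refine ContMDiffAt.sum fun i _ ↦ ?_
  exact (ContinuousLinearMap.smulRightL ℝ G F (LinearMap.toContinuousLinearMap
    (b.coord i))).contDiff.contMDiff.contMDiffAt.comp x (h (b i))

end

variable {E : Type*} [NormedAddCommGroup E] [NormedSpace ℝ E] [FiniteDimensional ℝ E]
  {H : Type*} [TopologicalSpace H] {I : ModelWithCorners ℝ E H}
  {M : Type*} [TopologicalSpace M] [ChartedSpace H M] [IsManifold I ∞ M]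

/-- The vector field with constant components `a` in the coordinate frame around `x`. -/
def coordField (x : M) (a : E) (y : M) : TangentSpace I y :=
  (trivializationAt E (TangentSpace I : M → Type _) x).symmL ℝ y a

/-- The components of a tangent vector in the coordinate frame around `x`. -/
def coordComp (x : M) {y : M} (v : TangentSpace I y) : E :=
  (trivializationAt E (TangentSpace I : M → Type _) x ⟨y, v⟩).2

lemma coordField_coordComp {x y : M} (hy : y ∈ (chartAt H x).source) (v : TangentSpace I y) :
    coordField x (coordComp x v) y = v := by
  have hy' : y ∈ (trivializationAt E (TangentSpace I : M → Type _) x).baseSet := hy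
  exact (Bundle.Trivialization.symmL_apply _ hy' _).trans
    (Bundle.Trivialization.symm_apply_apply_mk _ hy' v)

lemma coordComp_coordField {x y : M} (hy : y ∈ (chartAt H x).source) (a : E) :
    coordComp x (coordField (I := I) x a y) = a := by
  have hy' : y ∈ (trivializationAt E (TangentSpace I : M → Type _) x).baseSet := hy
  have h1 : coordField (I := I) x a y =
      (trivializationAt E (TangentSpace I : M → Type _) x).symm y a :=
    Bundle.Trivialization.symmL_apply _ hy' _
  rw [h1, coordComp, Bundle.Trivialization.apply_mk_symm _ hy']

lemma coordField_smul (x : M) (c : ℝ) (a : E) (y : M) :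
    coordField (I := I) x (c • a) y = c • coordField x a y := map_smul _ _ _

lemma coordField_sum {ι : Type*} (s : Finset ι) (x : M) (a : ι → E) (y : M) :
    coordField (I := I) x (∑ i ∈ s, a i) y = ∑ i ∈ s, coordField x (a i) y := map_sum _ _ _

lemma contMDiffAt_coordField {x y : M} (hy : y ∈ (chartAt H x).source) (a : E) :
    CMDiffAt ∞ (T% (coordField (I := I) x a)) y := by
  have : IsManifold I (∞ + 1) M := by simpa
  have hy' : y ∈ (trivializationAt E (TangentSpace I : M → Type _) x).baseSet := hy
  rw [Bundle.Trivialization.contMDiffAt_section_iff _ hy']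
  refine (contMDiffAt_const (c := a)).congr_of_eventuallyEq ?_
  filter_upwards [(chartAt H x).open_source.mem_nhds hy] with z hz
  exact coordComp_coordField hz a

lemma mdifferentiableAt_iff_coordComp {Y : Π x : M, TangentSpace I x} {x : M} :
    MDiffAt (T% Y) x ↔ MDiffAt (fun y ↦ coordComp x (Y y)) x :=
  mdifferentiableAt_section _ _

lemma contMDiffAt_iff_coordComp {n : WithTop ℕ∞} {Y : Π x : M, TangentSpace I x} {x : M} :
    CMDiffAt n (T% Y) x ↔ CMDiffAt n (fun y ↦ coordComp x (Y y)) x :=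
  contMDiffAt_section _

namespace LorentzianMetric

variable (h : LorentzianMetric I M) {x : M}

lemma contMDiffAt_inner {n : WithTop ℕ∞} (hn : n ≤ ∞) {V W : Π x : M, TangentSpace I x}
    (hV : CMDiffAt n (T% V) x) (hW : CMDiffAt n (T% W) x) :
    CMDiffAt n (fun y ↦ h.inner y (V y) (W y)) x := by
  have h1 : CMDiffAt n (fun y ↦ TotalSpace.mk' (E →L[ℝ] E →L[ℝ] ℝ)
      (E := fun x : M ↦ TangentSpace I x →L[ℝ] TangentSpace I x →L[ℝ] ℝ) y (h.inner y)) x :=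
    (h.contMDiff x).of_le hn
  have := ContMDiffAt.clm_bundle_apply₂ (F₁ := E) (F₂ := E) (F₃ := ℝ)
    (E₃ := Trivial M ℝ) (b := id) h1 hV hW
  rw [contMDiffAt_totalSpace] at this
  exact this.2

/-- A vector field is differentiable if its inner products with smooth vector fields are. -/
lemma mdifferentiableAt_of_inner {Z : Π x : M, TangentSpace I x}
    (hZ : ∀ W : Π x : M, TangentSpace I x, CMDiffAt ∞ (T% W) x →
      MDiffAt (fun y ↦ h.inner y (Z y) (W y)) x) : MDiffAt (T% Z) x := by
  rw [mdifferentiableAt_iff_coordComp]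
  have hx := mem_chart_source H x
  have hfield : ∀ a : E, CMDiffAt ∞ (T% (coordField (I := I) x a)) x := contMDiffAt_coordField hx
  let A : M → E →L[ℝ] E →L[ℝ] ℝ := fun y ↦
    let B : E →L[ℝ] E →L[ℝ] ℝ := h.inner y
    let S : E →L[ℝ] E := (trivializationAt E (TangentSpace I : M → Type _) x).symmL ℝ y
    B.bilinearComp S S
  have hAapp : ∀ y a b, A y a b = h.inner y (coordField x a y) (coordField x b y) :=
    fun y a b ↦ rfl
  let c : M → E →L[ℝ] ℝ := fun y ↦
    (h.inner y (Z y)).comp ((trivializationAt E (TangentSpace I : M → Type _) x).symmL ℝ y)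
  have hcapp : ∀ y b, c y b = h.inner y (Z y) (coordField x b y) := fun y b ↦ rfl
  have hA : MDiffAt A x := .clm_of_apply fun a ↦ .clm_of_apply fun b ↦
    (h.contMDiffAt_inner le_rfl (hfield a) (hfield b)).mdifferentiableAt (by simp)
  have hc : MDiffAt c x := .clm_of_apply fun b ↦ hZ _ (hfield b)
  have hinv : ∀ y ∈ (chartAt H x).source,
      ∃ e : E ≃L[ℝ] (E →L[ℝ] ℝ), (e : E →L[ℝ] E →L[ℝ] ℝ) = A y := by
    intro y hy
    have hinj : Function.Injective (A y).toLinearMap := by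
      rw [← LinearMap.ker_eq_bot, LinearMap.ker_eq_bot']
      intro a ha
      have h1 : coordField (I := I) x a y = 0 := h.eq_zero_of_inner fun w ↦ by
        have := congrArg (fun f : E →L[ℝ] ℝ ↦ f (coordComp x w)) ha
        change h.inner y (coordField x a y) (coordField x (coordComp x w) y) = 0 at this
        rwa [coordField_coordComp hy] at this
      have h2 : coordField (I := I) x (0 : E) y = 0 := map_zero _
      rw [← coordComp_coordField (I := I) hy a, h1, ← h2, coordComp_coordField hy]
    have hfin : finrank ℝ E = finrank ℝ (E →L[ℝ] ℝ) := by
      rw [← (LinearMap.toContinuousLinearMap (𝕜 := ℝ) (E := E) (F' := ℝ)).finrank_eq]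
      exact Subspace.dual_finrank_eq.symm
    let e : E ≃ₗ[ℝ] (E →L[ℝ] ℝ) := LinearEquiv.ofInjectiveOfFinrankEq (A y).toLinearMap hinj hfin
    exact ⟨e.toContinuousLinearEquiv, by ext; rfl⟩
  have hev : ∀ᶠ y in 𝓝 x, coordComp x (Z y) = ContinuousLinearMap.inverse (A y) (c y) := by
    filter_upwards [(chartAt H x).open_source.mem_nhds hx] with y hy
    obtain ⟨e, he⟩ := hinv y hy
    have h1 : A y (coordComp x (Z y)) = c y := by
      ext b
      rw [hAapp, hcapp, coordField_coordComp hy]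
    rw [← h1, ← he, ContinuousLinearMap.inverse_equiv]
    simp
  refine MDifferentiableAt.congr_of_eventuallyEq ?_ hev
  obtain ⟨e, he⟩ := hinv x hx
  exact hA.inverse_clm_apply hc he

end LorentzianMetric
end LeviCivitaRegularity

section CurvatureTensor

open Set Filter

section
variable {E : Type*} [NormedAddCommGroup E] [NormedSpace ℝ E] [FiniteDimensional ℝ E]
  {H : Type*} [TopologicalSpace H] {I : ModelWithCorners ℝ E H}
  {M : Type*} [TopologicalSpace M] [ChartedSpace H M] [IsManifold I ∞ M]
  {ι : Type*} [Fintype ι] {x : M}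

lemma coordField_eq_sum (b : Basis ι ℝ E) (x : M) (a : E) :
    coordField (I := I) x a = fun y ↦ ∑ i, b.coord i a • coordField (I := I) x (b i) y := by
  ext1 y
  conv_lhs => rw [← b.sum_repr a, coordField_sum]
  simp [coordField_smul]

lemma eventually_eq_sum_coordField (b : Basis ι ℝ E) (Y : Π x : M, TangentSpace I x) (x : M) :
    ∀ᶠ y in 𝓝 x, Y y = ∑ i, b.coord i (coordComp x (Y y)) • coordField x (b i) y := by
  filter_upwards [(chartAt H x).open_source.mem_nhds (mem_chart_source H x)] with y hy
  conv_lhs => rw [← coordField_coordComp hy (Y y), coordField_eq_sum b]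

lemma mdifferentiableAt_coordField (x : M) (a : E) : MDiffAt (T% (coordField (I := I) x a)) x :=
  (contMDiffAt_coordField (mem_chart_source H x) a).mdifferentiableAt (by simp)

lemma MDifferentiableAt.coord_coordComp (b : Basis ι ℝ E) {Y : Π x : M, TangentSpace I x}
    (hY : MDiffAt (T% Y) x) (i : ι) : MDiffAt (fun y ↦ b.coord i (coordComp x (Y y))) x :=
  (LinearMap.toContinuousLinearMap (b.coord i)).differentiableAt.mdifferentiableAt.comp x
    (mdifferentiableAt_iff_coordComp.1 hY)

lemma ContMDiffAt.coord_coordComp {n : WithTop ℕ∞} (b : Basis ι ℝ E)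
    {Y : Π x : M, TangentSpace I x}
    (hY : CMDiffAt n (T% Y) x) (i : ι) : CMDiffAt n (fun y ↦ b.coord i (coordComp x (Y y))) x :=
  (LinearMap.toContinuousLinearMap (b.coord i)).contDiff.contMDiff.contMDiffAt.comp x
    (contMDiffAt_iff_coordComp.1 hY)

namespace CovariantDerivative

variable (cov : CovariantDerivative I E (TangentSpace I : M → Type _))

lemma congr_of_eventuallyEq {Y Y' : Π x : M, TangentSpace I x} (hY : MDiffAt (T% Y) x)
    (hY' : MDiffAt (T% Y') x) (he : ∀ᶠ y in 𝓝 x, Y y = Y' y) : cov Y x = cov Y' x :=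
  (cov.isCovariantDerivativeOn (s := univ)).congr_of_eventuallyEq hY hY' univ_mem he

lemma add_apply {Y Y' : Π x : M, TangentSpace I x} (hY : MDiffAt (T% Y) x)
    (hY' : MDiffAt (T% Y') x) : cov (Y + Y') x = cov Y x + cov Y' x :=
  cov.isCovariantDerivativeOnUniv.add hY hY'

lemma smul_apply {Y : Π x : M, TangentSpace I x} {f : M → ℝ} (hf : MDiffAt f x)
    (hY : MDiffAt (T% Y) x) (v : TangentSpace I x) :
    cov (f • Y) x v = f x • cov Y x v + d% f x v • Y x := by
  rw [cov.isCovariantDerivativeOnUniv.leibniz hY hf]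
  rfl

lemma sub_apply {Y Y' : Π x : M, TangentSpace I x} (hY : MDiffAt (T% Y) x)
    (hY' : MDiffAt (T% Y') x) : cov (Y - Y') x = cov Y x - cov Y' x := by
  have h1 := cov.add_apply (mdifferentiableAt_sub_section hY hY') hY'
  rw [eq_sub_iff_add_eq, ← h1]
  congr 1
  ext1 y
  simp

lemma sum_smul_apply {c : ι → M → ℝ} {σ : ι → Π x : M, TangentSpace I x} (s : Finset ι)
    (hc : ∀ i, MDiffAt (c i) x) (hσ : ∀ i, MDiffAt (T% (σ i)) x) (v : TangentSpace I x) :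
    cov (fun y ↦ ∑ i ∈ s, c i y • σ i y) x v =
      ∑ i ∈ s, (c i x • cov (σ i) x v + d% (c i) x v • σ i x) := by
  classical
  induction s using Finset.induction_on with
  | empty =>
    have : cov (0 : Π x : M, TangentSpace I x) x v = 0 := by rw [cov.zero]; rfl
    simp only [Finset.sum_empty]
    exact this
  | insert a s ha ih =>
    simp only [Finset.sum_insert ha, ← ih]
    have := cov.add_apply (Y := c a • σ a) (Y' := fun y ↦ ∑ i ∈ s, c i y • σ i y)
      ((hc a).smul_section (hσ a))
      (.sum_section fun i _ ↦ (hc i).smul_section (hσ i))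
    rw [← cov.smul_apply (hc a) (hσ a)]
    exact congrArg (fun f : E →L[ℝ] E ↦ f v) this

/-- The covariant derivative in the coordinate frame around `x`. -/
lemma apply_eq_coordField {Y : Π x : M, TangentSpace I x} (hY : MDiffAt (T% Y) x)
    (v : TangentSpace I x) :
    cov Y x v = coordField x (d% (fun y ↦ coordComp x (Y y)) x v) x +
      cov (coordField x (coordComp x (Y x))) x v := by
  have b := finBasis ℝ E
  have hc := hY.coord_coordComp b
  have he : ∀ i, MDiffAt (T% (coordField (I := I) x (b i))) x :=
    fun i ↦ mdifferentiableAt_coordField x (b i)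
  have hd : ∀ i, d% (fun y ↦ b.coord i (coordComp x (Y y))) x v =
      b.coord i (d% (fun y ↦ coordComp x (Y y)) x v) := by
    intro i
    have h1 := mvfderiv_comp_apply x
      (LinearMap.toContinuousLinearMap (b.coord i)).differentiableAt.mdifferentiableAt
      (mdifferentiableAt_iff_coordComp.1 hY) v
    refine h1.trans ?_
    have h2 : d% (LinearMap.toContinuousLinearMap (b.coord i)) (coordComp x (Y x)) =
      LinearMap.toContinuousLinearMap (b.coord i) := by
      rw [mvfderiv, mfderiv_eq_fderiv, ContinuousLinearMap.fderiv]
      rfl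
    exact congrArg (fun f : E →L[ℝ] ℝ ↦ f _) h2
  have h0 : cov Y x =
      cov (fun y ↦ ∑ i, b.coord i (coordComp x (Y y)) • coordField x (b i) y) x :=
    cov.congr_of_eventuallyEq hY (.sum_section fun i _ ↦ (hc i).smul_section (he i))
      (eventually_eq_sum_coordField b Y x)
  rw [h0, cov.sum_smul_apply _ hc he, Finset.sum_add_distrib,
    add_comm]
  congr 1
  · simp only [hd]
    rw [coordField_eq_sum b]
  · rw [coordField_eq_sum b, cov.sum_smul_apply _ (fun i ↦ mdifferentiableAt_const) he]
    refine Finset.sum_congr rfl fun i _ ↦ ?_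
    rw [mvfderiv_const]
    simp

end CovariantDerivative
end

section
variable {E : Type*} [NormedAddCommGroup E] [NormedSpace ℝ E] [FiniteDimensional ℝ E]
  {H : Type*} [TopologicalSpace H] {I : ModelWithCorners ℝ E H} [I.Boundaryless]
  {M : Type*} [TopologicalSpace M] [ChartedSpace H M] [IsManifold I ∞ M] {x : M}

lemma eventually_contMDiffAt_section {n : ℕ} {V : Π x : M, TangentSpace I x}
    (hV : CMDiffAt ∞ (T% V) x) : ∀ᶠ y in 𝓝 x, CMDiffAt n (T% V) y := by
  have : IsManifold I n M := IsManifold.of_le (n := ∞) (WithTop.coe_le_coe.2 le_top)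
  have : IsManifold I (n + 1) M := IsManifold.of_le (n := ∞) (WithTop.coe_le_coe.2 le_top)
  exact (contMDiffAt_iff_contMDiffAt_nhds (by simp)).1 (hV.of_le (WithTop.coe_le_coe.2 le_top))

lemma eventually_mdifferentiableAt_section {V : Π x : M, TangentSpace I x}
    (hV : CMDiffAt ∞ (T% V) x) : ∀ᶠ y in 𝓝 x, MDiffAt (T% V) y := by
  filter_upwards [eventually_contMDiffAt_section (n := 1) hV] with y hy
  exact hy.mdifferentiableAt (by simp)

namespace LorentzianMetric
variable (h : LorentzianMetric I M)

lemma contMDiffAt_mlieBracket {U W : Π x : M, TangentSpace I x} (hU : CMDiffAt ∞ (T% U) x)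
    (hW : CMDiffAt ∞ (T% W) x) : CMDiffAt ∞ (T% (mlieBracket I U W)) x := by
  have : IsManifold I ((⊤ : ℕ∞) + 1) M := IsManifold.of_le (n := ∞) (by simp)
  have : IsManifold I (minSmoothness ℝ 3) M := by
    rw [minSmoothness_of_isRCLikeNormedField]
    exact IsManifold.of_le (n := ∞) (WithTop.coe_le_coe.2 le_top)
  exact ContMDiffAt.mlieBracket_vectorField (n := ⊤) (m := ⊤) hU hW (by simp)

lemma mdifferentiableAt_leviCivita_of_contMDiffAt {U W : Π x : M, TangentSpace I x}
    (hW : CMDiffAt ∞ (T% W) x) (hU : CMDiffAt ∞ (T% U) x) :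
    MDiffAt (T% (fun y ↦ h.leviCivita W y (U y))) x := by
  refine h.mdifferentiableAt_of_inner fun Z hZ ↦ ?_
  have h2 : (2 : WithTop ℕ∞) ≤ ∞ := WithTop.coe_le_coe.2 le_top
  have hd : ∀ {A B : Π x : M, TangentSpace I x}, CMDiffAt ∞ (T% A) x → CMDiffAt ∞ (T% B) x →
      MDiffAt (fun y ↦ h.inner y (A y) (B y)) x := fun hA hB ↦
    (h.contMDiffAt_inner le_rfl hA hB).mdifferentiableAt (by simp)
  have hdd : ∀ {A B C : Π x : M, TangentSpace I x}, CMDiffAt ∞ (T% A) x → CMDiffAt ∞ (T% B) x →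
      CMDiffAt ∞ (T% C) x →
      MDiffAt (fun y ↦ d% (fun y ↦ h.inner y (A y) (B y)) y (C y)) x := fun hA hB hC ↦
    mdifferentiableAt_mvfderiv_apply ((h.contMDiffAt_inner le_rfl hA hB).of_le h2)
      (hC.mdifferentiableAt (by simp))
  have hk : MDiffAt (h.koszul W U Z) x :=
    (((((hdd hW hZ hU).add (hdd hU hZ hW)).sub (hdd hU hW hZ)).add
      (hd (contMDiffAt_mlieBracket hU hW) hZ)).sub (hd (contMDiffAt_mlieBracket hU hZ) hW)).sub
      (hd (contMDiffAt_mlieBracket hW hZ) hU) |>.const_smul (1 / 2 : ℝ)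
  refine hk.congr_of_eventuallyEq ?_
  filter_upwards [eventually_mdifferentiableAt_section hU, eventually_mdifferentiableAt_section hW,
    eventually_mdifferentiableAt_section hZ] with y h1 h2 h3
  exact h.inner_nablaAux h2 h1 h3

lemma mdifferentiableAt_leviCivita {U W : Π x : M, TangentSpace I x} (hW : CMDiffAt ∞ (T% W) x)
    (hU : MDiffAt (T% U) x) : MDiffAt (T% (fun y ↦ h.leviCivita W y (U y))) x := by
  have b := finBasis ℝ E
  have h1 : MDiffAt (T% (fun y ↦ ∑ i, b.coord i (coordComp x (U y)) •
      h.leviCivita W y (coordField x (b i) y))) x :=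
    .sum_section fun i _ ↦ (hU.coord_coordComp b i).smul_section
      (h.mdifferentiableAt_leviCivita_of_contMDiffAt hW
        (contMDiffAt_coordField (mem_chart_source H x) (b i)))
  refine h1.congr_of_eventuallyEq ?_
  filter_upwards [eventually_eq_sum_coordField b U x] with y hy
  congr 1
  conv_lhs => rw [hy, map_sum]
  simp

section Curvature
variable {U V W : Π x : M, TangentSpace I x}

lemma curvature_swap (U V W : Π x : M, TangentSpace I x) (x : M) :
    h.leviCivita.curvature V U W x = - h.leviCivita.curvature U V W x := by
  simp only [CovariantDerivative.curvature, mlieBracket_swap_apply (V := V) (W := U), map_neg]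
  abel

lemma curvature_tensorialAt_left (V : Π x : M, TangentSpace I x) (hW : CMDiffAt ∞ (T% W) x) :
    TensorialAt I E (fun U ↦ h.leviCivita.curvature U V W x) x where
  smul {f U} hf hU := by
    have e1 : (fun y ↦ h.leviCivita W y ((f • U) y)) = f • fun y ↦ h.leviCivita W y (U y) := by
      ext1 y; simp
    have e2 : ∀ v, h.leviCivita (fun y ↦ h.leviCivita W y ((f • U) y)) x v = _ := fun v ↦ by
      rw [e1, h.leviCivita.smul_apply hf (h.mdifferentiableAt_leviCivita hW hU)]
    change h.leviCivita.curvature (f • U) V W x = f x • h.leviCivita.curvature U V W x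
    rw [CovariantDerivative.curvature, e2, mlieBracket_smul_left hf hU]
    simp only [CovariantDerivative.curvature, map_add, map_smul, Pi.smul_apply', neg_smul, smul_sub,
      map_neg]
    abel
  add {U U'} hU hU' := by
    have e1 : (fun y ↦ h.leviCivita W y ((U + U') y)) =
        (fun y ↦ h.leviCivita W y (U y)) + fun y ↦ h.leviCivita W y (U' y) := by
      ext1 y; simp
    have e2 : h.leviCivita (fun y ↦ h.leviCivita W y ((U + U') y)) x =
        h.leviCivita (fun y ↦ h.leviCivita W y (U y)) x +
          h.leviCivita (fun y ↦ h.leviCivita W y (U' y)) x := by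
      rw [e1, h.leviCivita.add_apply (h.mdifferentiableAt_leviCivita hW hU)
        (h.mdifferentiableAt_leviCivita hW hU')]
    rw [CovariantDerivative.curvature, e2, mlieBracket_add_left hU hU']
    simp only [CovariantDerivative.curvature, map_add, Pi.add_apply, _root_.add_apply]
    abel

lemma curvature_congr_third {W' : Π x : M, TangentSpace I x} (hU : MDiffAt (T% U) x)
    (hV : MDiffAt (T% V) x) (hW : CMDiffAt ∞ (T% W) x) (hW' : CMDiffAt ∞ (T% W') x)
    (he : ∀ᶠ y in 𝓝 x, W y = W' y) :
    h.leviCivita.curvature U V W x = h.leviCivita.curvature U V W' x := by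
  have h1 : ∀ {A : Π x : M, TangentSpace I x}, MDiffAt (T% A) x →
      h.leviCivita (fun y ↦ h.leviCivita W y (A y)) x =
        h.leviCivita (fun y ↦ h.leviCivita W' y (A y)) x := by
    intro A hA
    refine h.leviCivita.congr_of_eventuallyEq (h.mdifferentiableAt_leviCivita hW hA)
      (h.mdifferentiableAt_leviCivita hW' hA) ?_
    filter_upwards [eventually_mdifferentiableAt_section hW,
      eventually_mdifferentiableAt_section hW', he.eventually_nhds] with y h1 h2 h3
    rw [h.leviCivita.congr_of_eventuallyEq h1 h2 h3]
  rw [CovariantDerivative.curvature, h1 hV, h1 hU, h.leviCivita.congr_of_eventuallyEq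
    (hW.mdifferentiableAt (by simp)) (hW'.mdifferentiableAt (by simp)) he]
  rfl

lemma curvature_add_third {W' : Π x : M, TangentSpace I x} (hU : MDiffAt (T% U) x)
    (hV : MDiffAt (T% V) x) (hW : CMDiffAt ∞ (T% W) x) (hW' : CMDiffAt ∞ (T% W') x) :
    h.leviCivita.curvature U V (W + W') x =
      h.leviCivita.curvature U V W x + h.leviCivita.curvature U V W' x := by
  have h1 : ∀ {A : Π x : M, TangentSpace I x}, MDiffAt (T% A) x →
      h.leviCivita (fun y ↦ h.leviCivita (W + W') y (A y)) x =
        h.leviCivita (fun y ↦ h.leviCivita W y (A y)) x +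
        h.leviCivita (fun y ↦ h.leviCivita W' y (A y)) x := by
    intro A hA
    have hs : CMDiffAt ∞ (T% (W + W')) x := hW.add_section hW'
    rw [← h.leviCivita.add_apply (h.mdifferentiableAt_leviCivita hW hA)
      (h.mdifferentiableAt_leviCivita hW' hA)]
    refine h.leviCivita.congr_of_eventuallyEq (h.mdifferentiableAt_leviCivita hs hA)
      (mdifferentiableAt_add_section (h.mdifferentiableAt_leviCivita hW hA)
      (h.mdifferentiableAt_leviCivita hW' hA)) ?_
    filter_upwards [eventually_mdifferentiableAt_section hW,
      eventually_mdifferentiableAt_section hW'] with y h1 h2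
    rw [h.leviCivita.add_apply h1 h2]
    rfl
  rw [CovariantDerivative.curvature, h1 hV, h1 hU, h.leviCivita.add_apply
    (hW.mdifferentiableAt (by simp)) (hW'.mdifferentiableAt (by simp))]
  simp only [CovariantDerivative.curvature, _root_.add_apply]
  abel

lemma curvature_smul_third {f : M → ℝ} (hf : CMDiffAt ∞ f x) (hU : MDiffAt (T% U) x)
    (hV : MDiffAt (T% V) x) (hW : CMDiffAt ∞ (T% W) x) :
    h.leviCivita.curvature U V (f • W) x = f x • h.leviCivita.curvature U V W x := by
  have h2 : (2 : WithTop ℕ∞) ≤ ∞ := WithTop.coe_le_coe.2 le_top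
  have hfd : MDiffAt f x := hf.mdifferentiableAt (by simp)
  have hWd : MDiffAt (T% W) x := hW.mdifferentiableAt (by simp)
  have : IsManifold I 2 M := IsManifold.of_le (n := ∞) h2
  have h1 : ∀ {A : Π x : M, TangentSpace I x}, MDiffAt (T% A) x → ∀ v,
      h.leviCivita (fun y ↦ h.leviCivita (f • W) y (A y)) x v =
        f x • h.leviCivita (fun y ↦ h.leviCivita W y (A y)) x v +
        d% f x v • h.leviCivita W x (A x) + d% f x (A x) • h.leviCivita W x v +
        d% (fun y ↦ d% f y (A y)) x v • W x := by
    intro A hA v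
    have hs : CMDiffAt ∞ (T% (f • W)) x := hf.smul_section hW
    have hnW := h.mdifferentiableAt_leviCivita hW hA
    have hdf : MDiffAt (fun y ↦ d% f y (A y)) x := mdifferentiableAt_mvfderiv_apply (hf.of_le h2) hA
    have e1 : h.leviCivita (fun y ↦ h.leviCivita (f • W) y (A y)) x =
        h.leviCivita ((f • fun y ↦ h.leviCivita W y (A y)) + (fun y ↦ d% f y (A y)) • W) x := by
      refine h.leviCivita.congr_of_eventuallyEq (h.mdifferentiableAt_leviCivita hs hA)
        (mdifferentiableAt_add_section (hfd.smul_section hnW) (hdf.smul_section hWd)) ?_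
      filter_upwards [eventually_mdifferentiableAt_section hW,
        (contMDiffAt_iff_contMDiffAt_nhds (by simp)).1 (hf.of_le h2)] with y h1 h2
      rw [h.leviCivita.smul_apply (h2.mdifferentiableAt two_ne_zero) h1]
      rfl
    rw [e1, h.leviCivita.add_apply (hfd.smul_section hnW) (hdf.smul_section hWd)]
    refine (congrArg₂ (· + ·) (h.leviCivita.smul_apply hfd hnW v)
      (h.leviCivita.smul_apply hdf hWd v)).trans ?_
    abel
  rw [CovariantDerivative.curvature, h1 hV, h1 hU, h.leviCivita.smul_apply hfd hWd,
    mvfderiv_mlieBracket (hf.of_le h2) hU hV]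
  simp only [CovariantDerivative.curvature, smul_sub, sub_smul]
  abel

/-- The curvature tensor depends only on the values of the vector fields at the point. -/
lemma curvature_congr {U' V' W' : Π x : M, TangentSpace I x} (hU : MDiffAt (T% U) x)
    (hV : MDiffAt (T% V) x) (hW : CMDiffAt ∞ (T% W) x) (hU' : MDiffAt (T% U') x)
    (hV' : MDiffAt (T% V') x) (hW' : CMDiffAt ∞ (T% W') x) (eU : U x = U' x) (eV : V x = V' x)
    (eW : W x = W' x) :
    h.leviCivita.curvature U V W x = h.leviCivita.curvature U' V' W' x := by
  have b := finBasis ℝ E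
  have hs : ∀ (s : Finset (Fin (finrank ℝ E))) (c : Fin (finrank ℝ E) → M → ℝ),
      (∀ i, CMDiffAt ∞ (c i) x) →
      CMDiffAt ∞ (T% (fun y ↦ ∑ i ∈ s, c i y • coordField (I := I) x (b i) y)) x := fun s c hc ↦
    .sum_section fun i _ ↦ (hc i).smul_section (contMDiffAt_coordField (mem_chart_source H x) _)
  have h0 : h.leviCivita.curvature U V (0 : Π x : M, TangentSpace I x) x = 0 := by
    have h1 : ∀ A : Π x : M, TangentSpace I x,
        (fun y ↦ h.leviCivita (0 : Π x : M, TangentSpace I x) y (A y)) = 0 := by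
      intro A; ext1 y; rw [CovariantDerivative.zero]; rfl
    rw [CovariantDerivative.curvature, h1, h1, CovariantDerivative.zero]
    simp
  have hsum : ∀ (s : Finset (Fin (finrank ℝ E))) (c : Fin (finrank ℝ E) → M → ℝ),
      (∀ i, CMDiffAt ∞ (c i) x) →
      h.leviCivita.curvature U V (fun y ↦ ∑ i ∈ s, c i y • coordField x (b i) y) x =
        ∑ i ∈ s, c i x • h.leviCivita.curvature U V (coordField x (b i)) x := by
    intro s c hc
    induction s using Finset.induction_on with
    | empty => simp only [Finset.sum_empty]; exact h0
    | insert a s ha ih =>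
      simp only [Finset.sum_insert ha, ← ih]
      rw [← h.curvature_smul_third (hc a) hU hV (contMDiffAt_coordField (mem_chart_source H x) _),
        ← h.curvature_add_third hU hV ((hc a).smul_section
          (contMDiffAt_coordField (mem_chart_source H x) _)) (hs s c hc)]
      rfl
  have hexp : ∀ {A : Π x : M, TangentSpace I x}, CMDiffAt ∞ (T% A) x →
      h.leviCivita.curvature U V A x =
        ∑ i, b.coord i (coordComp x (A x)) • h.leviCivita.curvature U V (coordField x (b i)) x := by
    intro A hA
    rw [← hsum Finset.univ (fun i y ↦ b.coord i (coordComp x (A y))) fun i ↦ hA.coord_coordComp b i]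
    exact h.curvature_congr_third hU hV hA (hs _ _ fun i ↦ hA.coord_coordComp b i)
      (eventually_eq_sum_coordField b A x)
  have h1 : h.leviCivita.curvature U V W x = h.leviCivita.curvature U V W' x := by
    rw [hexp hW, hexp hW', eW]
  have h2 : h.leviCivita.curvature U V W' x = h.leviCivita.curvature U' V W' x :=
    (h.curvature_tensorialAt_left V hW').pointwise hU hU' eU
  have h3 : h.leviCivita.curvature V U' W' x = h.leviCivita.curvature V' U' W' x :=
    (h.curvature_tensorialAt_left U' hW').pointwise hV hV' eV
  rw [h1, h2, ← neg_inj, ← h.curvature_swap, ← h.curvature_swap, h3]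

end Curvature
end LorentzianMetric
end
end CurvatureTensor

section Immersion

open Set Filter

variable {E : Type*} [NormedAddCommGroup E] [NormedSpace ℝ E] [FiniteDimensional ℝ E]
  {H : Type*} [TopologicalSpace H] {I : ModelWithCorners ℝ E H} [I.Boundaryless]
  {M : Type*} [TopologicalSpace M] [ChartedSpace H M] [IsManifold I ∞ M]
  {E' : Type*} [NormedAddCommGroup E'] [NormedSpace ℝ E'] [FiniteDimensional ℝ E']
  {H' : Type*} [TopologicalSpace H'] {I' : ModelWithCorners ℝ E' H'} [I'.Boundaryless]
  {N : Type*} [TopologicalSpace N] [ChartedSpace H' N] [IsManifold I' ∞ N]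
  {ι : N → M} {q : N}

lemma mvfderiv_comp_mfderiv {F : Type*} [NormedAddCommGroup F] [NormedSpace ℝ F] {g : M → F}
    (q : N) (hg : MDiffAt g (ι q)) (hι : MDiffAt ι q) (v : TangentSpace I' q) :
    d% (g ∘ ι) q v = d% g (ι q) (mfderiv I' I ι q v) :=
  mfderiv_comp_apply q hg hι v

lemma coordComp_eq_mfderiv_extChartAt {x y : M} (hy : y ∈ (chartAt H x).source)
    (v : TangentSpace I y) : coordComp x v = mfderiv I 𝓘(ℝ, E) (extChartAt I x) y v := by
  have : IsManifold I 1 M := IsManifold.of_le (n := ∞) (by simp)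
  have hy' : y ∈ (trivializationAt E (TangentSpace I : M → Type _) x).baseSet := hy
  have h1 := TangentBundle.continuousLinearMapAt_trivializationAt (I := I) hy
  refine Eq.trans ?_ (congrArg (fun f : E →L[ℝ] E ↦ f v) h1)
  exact ((trivializationAt E (TangentSpace I : M → Type _) x).continuousLinearMapAt_apply_of_mem
    (R := ℝ) hy' v).symm

/-- The coordinates around a point of an immersed manifold extend to the ambient manifold. -/
lemma exists_comp_eq_extChartAt (hι : CMDiffAt ∞ ι q)
    (hinj : Function.Injective (mfderiv I' I ι q)) :
    ∃ f : M → E', CMDiffAt ∞ f (ι q) ∧ ∀ᶠ q' in 𝓝 q, f (ι q') = extChartAt I' q q' := by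
  have : IsManifold I 1 M := IsManifold.of_le (n := ∞) (by simp)
  have : IsManifold I' 1 N := IsManifold.of_le (n := ∞) (by simp)
  have hφ : CMDiffAt ∞ (extChartAt I (ι q)) (ι q) := contMDiffAt_extChartAt
  have hk : CMDiffAt ∞ (extChartAt I (ι q) ∘ ι) q := hφ.comp q hι
  have hq := mem_extChartAt_source (I := I') q
  set g := (extChartAt I (ι q) ∘ ι) ∘ (extChartAt I' q).symm with hg
  have hgc : ContDiffAt ℝ ∞ g (extChartAt I' q q) := contDiffAt_comp_extChartAt_symm hk
  have hginj : Function.Injective (fderiv ℝ g (extChartAt I' q q)) := by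
    obtain ⟨e, he⟩ := isInvertible_mfderiv_extChartAt (I := I') hq
    obtain ⟨e', he'⟩ := isInvertible_mfderiv_extChartAt (I := I)
      (mem_extChartAt_source (I := I) (ι q))
    rw [injective_iff_map_eq_zero]
    intro a ha
    have h1 := mvfderiv_eq_fderiv_extChartAt hq (hk.mdifferentiableAt (by simp)) (e.symm a)
    have h2 : mfderiv I' 𝓘(ℝ, E') (extChartAt I' q) q (e.symm a) = a := by
      rw [← he]; exact e.apply_symm_apply a
    have h3 := mvfderiv_comp_mfderiv q (hφ.mdifferentiableAt (by simp))
      (hι.mdifferentiableAt (by simp)) (e.symm a)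
    have h4 : e' (mfderiv I' I ι q (e.symm a)) = 0 := by
      refine (congrArg (fun f : E →L[ℝ] E ↦ f (mfderiv I' I ι q (e.symm a))) he').trans ?_
      refine h3.symm.trans (h1.trans ?_)
      rw [h2, ha]
      rfl
    have h5 : mfderiv I' I ι q (e.symm a) = 0 := e'.map_eq_zero_iff.1 h4
    have h6 : e.symm a = 0 := hinj (h5.trans (map_zero _).symm)
    exact e.symm.map_eq_zero_iff.1 h6
  obtain ⟨L₀, hL₀⟩ := (fderiv ℝ g (extChartAt I' q q)).toLinearMap.exists_leftInverse_of_injective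
    (LinearMap.ker_eq_bot.2 hginj)
  let L : E →L[ℝ] E' := LinearMap.toContinuousLinearMap L₀
  have hLg : ContDiffAt ℝ ∞ (L ∘ g) (extChartAt I' q q) := L.contDiff.contDiffAt.comp _ hgc
  have hd : HasFDerivAt (L ∘ g) ((ContinuousLinearEquiv.refl ℝ E' : E' ≃L[ℝ] E') : E' →L[ℝ] E')
      (extChartAt I' q q) := by
    have := L.hasFDerivAt.comp (extChartAt I' q q)
      (hgc.differentiableAt (by simp)).hasFDerivAt
    convert this using 1
    ext a
    exact (congrArg (fun f : E' →ₗ[ℝ] E' ↦ f a) hL₀).symm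
  have hs := hLg.hasStrictFDerivAt' hd (by simp)
  refine ⟨hLg.localInverse hd (by simp) ∘ L ∘ extChartAt I (ι q), ?_, ?_⟩
  · have h1 : ContDiffAt ℝ ∞ (hLg.localInverse hd (by simp)) (L (extChartAt I (ι q) (ι q))) := by
      have := hLg.to_localInverse hd (by simp)
      simpa [hg] using this
    exact (h1.contMDiffAt.comp (ι q) (L.contDiff.contMDiff.contMDiffAt.comp (ι q) hφ))
  · have h1 := hs.eventually_left_inverse
    have h2 : Tendsto (extChartAt I' q) (𝓝 q) (𝓝 (extChartAt I' q q)) :=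
      (continuousAt_extChartAt q)
    filter_upwards [h2.eventually h1, extChartAt_source_mem_nhds (I := I') q] with q' h3 h4
    simp only [Function.comp_apply, hg, (extChartAt I' q).left_inv h4] at h3
    exact h3

/-- A vector field along an immersed manifold extends to the ambient manifold. -/
lemma exists_vectorField_extension (hι : CMDiffAt ∞ ι q)
    (hinj : Function.Injective (mfderiv I' I ι q)) (w : Π q : N, TangentSpace I (ι q)) :
    ∃ W : Π x : M, TangentSpace I x,
      (MDiffAt (fun q' ↦ coordComp (ι q) (w q')) q → MDiffAt (T% W) (ι q)) ∧
      (CMDiffAt ∞ (fun q' ↦ coordComp (ι q) (w q')) q → CMDiffAt ∞ (T% W) (ι q)) ∧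
      ∀ᶠ q' in 𝓝 q, W (ι q') = w q' := by
  have : IsManifold I' 1 N := IsManifold.of_le (n := ∞) (by simp)
  obtain ⟨f, hf, he⟩ := exists_comp_eq_extChartAt hι hinj
  have hq := mem_extChartAt_source (I := I') q
  have hfq : f (ι q) = extChartAt I' q q := he.self_of_nhds
  let c : E' → E := (fun q' ↦ coordComp (ι q) (w q')) ∘ (extChartAt I' q).symm
  let W : Π x : M, TangentSpace I x := fun y ↦ coordField (ι q) (c (f y)) y
  have hcomp : ∀ᶠ y in 𝓝 (ι q), coordComp (ι q) (W y) = c (f y) := by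
    filter_upwards [(chartAt H (ι q)).open_source.mem_nhds (mem_chart_source H (ι q))] with y hy
    exact coordComp_coordField hy _
  refine ⟨W, fun h ↦ ?_, fun h ↦ ?_, ?_⟩
  · rw [mdifferentiableAt_iff_coordComp]
    refine MDifferentiableAt.congr_of_eventuallyEq ?_ hcomp
    have hψ : MDifferentiableAt 𝓘(ℝ, E') I' (extChartAt I' q).symm (extChartAt I' q q) := by
      have h := mdifferentiableWithinAt_extChartAt_symm (I := I') ((extChartAt I' q).map_source hq)
      rwa [I'.range_eq_univ, mdifferentiableWithinAt_univ] at h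
    have hc : MDifferentiableAt 𝓘(ℝ, E') 𝓘(ℝ, E) c (f (ι q)) := by
      rw [hfq]
      exact MDifferentiableAt.comp (extChartAt I' q q) (I' := I')
        (by rwa [(extChartAt I' q).left_inv hq]) hψ
    exact hc.comp (ι q) (hf.mdifferentiableAt (by simp))
  · rw [contMDiffAt_iff_coordComp]
    refine ContMDiffAt.congr_of_eventuallyEq ?_ hcomp
    have hc : ContDiffAt ℝ ∞ c (f (ι q)) := by
      rw [hfq]; exact contDiffAt_comp_extChartAt_symm h
    exact hc.contMDiffAt.comp (ι q) hf
  · filter_upwards [he, extChartAt_source_mem_nhds (I := I') q,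
      hι.continuousAt.preimage_mem_nhds ((chartAt H (ι q)).open_source.mem_nhds
      (mem_chart_source H (ι q)))] with q' h1 h2 h3
    have h4 : c (f (ι q')) = coordComp (ι q) (w q') := by
      rw [h1]
      exact congrArg (fun q' ↦ coordComp (ι q) (w q')) ((extChartAt I' q).left_inv h2)
    change coordField (ι q) (c (f (ι q'))) (ι q') = w q'
    rw [h4]
    exact coordField_coordComp h3 _

lemma MDifferentiableAt.coordComp_mfderiv (hι : CMDiff ∞ ι) {V : Π q : N, TangentSpace I' q}
    (hV : MDiffAt (T% V) q) : MDiffAt (fun q' ↦ coordComp (ι q) (mfderiv I' I ι q' (V q'))) q := by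
  have h1 := (hι.contMDiff_tangentMap (m := 1) (WithTop.coe_le_coe.2 le_top)).mdifferentiable
    (by simp)
  have h2 := (h1 ⟨q, V q⟩).comp q (f := T% V) hV
  exact (mdifferentiableAt_totalSpace _ _ |>.1 h2).2

lemma ContMDiffAt.coordComp_mfderiv (hι : CMDiff ∞ ι) {V : Π q : N, TangentSpace I' q}
    (hV : CMDiffAt ∞ (T% V) q) :
    CMDiffAt ∞ (fun q' ↦ coordComp (ι q) (mfderiv I' I ι q' (V q'))) q := by
  have h1 := (hι.contMDiff_tangentMap (m := ∞) (by simp))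
  have h2 := (h1 ⟨q, V q⟩).comp q (f := T% V) hV
  exact (contMDiffAt_totalSpace.1 h2).2

/-- A vector field on an immersed manifold is differentiable if its image is the restriction of a
differentiable vector field. -/
lemma mdifferentiableAt_of_mfderiv_eq (hι : CMDiff ∞ ι)
    (hinj : Function.Injective (mfderiv I' I ι q)) {Z : Π q : N, TangentSpace I' q}
    {Y : Π x : M, TangentSpace I x} (hY : MDiffAt (T% Y) (ι q))
    (he : ∀ᶠ q' in 𝓝 q, mfderiv I' I ι q' (Z q') = Y (ι q')) : MDiffAt (T% Z) q := by
  have h2 : (2 : WithTop ℕ∞) ≤ ∞ := WithTop.coe_le_coe.2 le_top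
  have : IsManifold I 2 M := IsManifold.of_le (n := ∞) h2
  obtain ⟨f, hf, hfe⟩ := exists_comp_eq_extChartAt (hι q) hinj
  rw [mdifferentiableAt_iff_coordComp]
  refine ((mdifferentiableAt_mvfderiv_apply (hf.of_le h2) hY).comp q
    ((hι q).mdifferentiableAt (by simp))).congr_of_eventuallyEq ?_
  filter_upwards [he, hfe.eventually_nhds, (chartAt H' q).open_source.mem_nhds
    (mem_chart_source H' q), (hι q).continuousAt.eventually
      ((contMDiffAt_iff_contMDiffAt_nhds (by simp)).1 (hf.of_le h2))] with q' h3 h4 h5 h6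
  have h7 : f ∘ ι =ᶠ[𝓝 q'] extChartAt I' q := h4
  rw [coordComp_eq_mfderiv_extChartAt h5, ← h7.mfderiv_eq, Function.comp_apply, ← h3]
  exact mvfderiv_comp_mfderiv q' (h6.mdifferentiableAt two_ne_zero)
    ((hι q').mdifferentiableAt (by simp)) _

/-- The Lie bracket is natural with respect to smooth maps. -/
lemma mfderiv_mlieBracket_of_related (hι : CMDiff ∞ ι) {U V : Π q : N, TangentSpace I' q}
    {U' V' : Π x : M, TangentSpace I x} (hU : MDiffAt (T% U) q) (hV : MDiffAt (T% V) q)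
    (hU' : MDiffAt (T% U') (ι q)) (hV' : MDiffAt (T% V') (ι q))
    (eU : ∀ᶠ q' in 𝓝 q, mfderiv I' I ι q' (U q') = U' (ι q'))
    (eV : ∀ᶠ q' in 𝓝 q, mfderiv I' I ι q' (V q') = V' (ι q')) :
    mfderiv I' I ι q (mlieBracket I' U V q) = mlieBracket I U' V' (ι q) := by
  have h2 : (2 : WithTop ℕ∞) ≤ ∞ := WithTop.coe_le_coe.2 le_top
  have : IsManifold I 2 M := IsManifold.of_le (n := ∞) h2
  have : IsManifold I 1 M := IsManifold.of_le (n := ∞) (by simp)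
  let f : M → E := extChartAt I (ι q)
  have hf : CMDiffAt 2 f (ι q) := contMDiffAt_extChartAt
  have hιd : ∀ q', MDiffAt ι q' := fun q' ↦ (hι q').mdifferentiableAt (by simp)
  obtain ⟨e, he⟩ := isInvertible_mfderiv_extChartAt (I := I) (mem_extChartAt_source (I := I) (ι q))
  have hder : ∀ {A : Π q : N, TangentSpace I' q} {A' : Π x : M, TangentSpace I x},
      MDiffAt (T% A') (ι q) → (∀ᶠ q' in 𝓝 q, mfderiv I' I ι q' (A q') = A' (ι q')) → ∀ v,
      d% (fun q' ↦ d% (f ∘ ι) q' (A q')) q v =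
        d% (fun y ↦ d% f y (A' y)) (ι q) (mfderiv I' I ι q v) := by
    intro A A' hA' eA v
    have h1 : (fun q' ↦ d% (f ∘ ι) q' (A q')) =ᶠ[𝓝 q] (fun y ↦ d% f y (A' y)) ∘ ι := by
      filter_upwards [eA, (hι q).continuousAt.eventually
        ((contMDiffAt_iff_contMDiffAt_nhds (by simp)).1 hf)] with q' h3 h4
      rw [Function.comp_apply, ← h3]
      exact mvfderiv_comp_mfderiv q' (h4.mdifferentiableAt two_ne_zero) (hιd q') _
    have h5 : d% (fun q' ↦ d% (f ∘ ι) q' (A q')) q = d% ((fun y ↦ d% f y (A' y)) ∘ ι) q :=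
      h1.mfderiv_eq
    rw [h5]
    exact mvfderiv_comp_mfderiv q (mdifferentiableAt_mvfderiv_apply hf hA') (hιd q) v
  have h6 := mvfderiv_mlieBracket (f := f ∘ ι) (hf.comp q ((hι q).of_le h2)) hU hV
  rw [hder hV' eV, hder hU' eU, eU.self_of_nhds, eV.self_of_nhds,
    ← mvfderiv_mlieBracket hf hU' hV'] at h6
  have h7 := (mvfderiv_comp_mfderiv q (hf.mdifferentiableAt two_ne_zero) (hιd q)
    (mlieBracket I' U V q)).symm.trans h6
  have hi : Function.Injective (mfderiv I 𝓘(ℝ, E) (extChartAt I (ι q)) (ι q)) := by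
    rw [← he]
    exact e.injective
  exact hi h7

end Immersion

section ScreenCurvature

open Set Filter

variable {n : ℕ} {M : Type u} [TopologicalSpace M]
  [ChartedSpace (EuclideanSpace ℝ (Fin (n + 2))) M] [IsManifold (𝓡 (n + 2)) ∞ M]

namespace LightlikeHypersurface

variable {h : LorentzianMetric (𝓡 (n + 2)) M} {X : Π x : M, TangentSpace (𝓡 (n + 2)) x}
  (N : LightlikeHypersurface h X) {q : N.carrier}

lemma mdifferentiableAt_incl (q : N.carrier) :
    MDifferentiableAt (𝓡 (n + 1)) (𝓡 (n + 2)) N.incl q :=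
  (N.contMDiff q).mdifferentiableAt (by simp)

lemma covAlong_congr {w w' : Π q : N.carrier, TangentSpace (𝓡 (n + 2)) (N.incl q)}
    (he : ∀ᶠ q' in 𝓝 q, w q' = w' q') (u : TangentSpace (𝓡 (n + 1)) q) :
    N.covAlong w q u = N.covAlong w' q u := by
  have h1 : (fun q' ↦ coordComp (N.incl q) (w q')) =ᶠ[𝓝 q] fun q' ↦ coordComp (N.incl q) (w' q') :=
    by
    filter_upwards [he] with q' hq'
    rw [hq']
  have h2 : mvfderiv (𝓡 (n + 1)) (fun q' ↦ coordComp (N.incl q) (w q')) q =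
    mvfderiv (𝓡 (n + 1)) (fun q' ↦ coordComp (N.incl q) (w' q')) q := h1.mfderiv_eq
  simp only [covAlong, he.self_of_nhds]
  congr 2
  exact congrArg (fun f : EuclideanSpace ℝ (Fin (n + 1)) →L[ℝ] EuclideanSpace ℝ (Fin (n + 2)) ↦ f u)
    h2

lemma covAlong_comp_incl {Y : Π x : M, TangentSpace (𝓡 (n + 2)) x}
    (hY : MDifferentiableAt (𝓡 (n + 2)) (𝓡 (n + 2)).tangent (T% Y) (N.incl q))
    (u : TangentSpace (𝓡 (n + 1)) q) :
    N.covAlong (fun q' ↦ Y (N.incl q')) q u =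
      h.leviCivita Y (N.incl q) (mfderiv (𝓡 (n + 1)) (𝓡 (n + 2)) N.incl q u) := by
  rw [h.leviCivita.apply_eq_coordField hY, ← mvfderiv_comp_mfderiv q
    (mdifferentiableAt_iff_coordComp.1 hY) (N.mdifferentiableAt_incl q)]
  have h1 : h.leviCivita (extend (EuclideanSpace ℝ (Fin (n + 2))) (Y (N.incl q))) (N.incl q) =
      h.leviCivita (coordField (N.incl q) (coordComp (N.incl q) (Y (N.incl q)))) (N.incl q) := by
    refine h.leviCivita.congr_of_eventuallyEq (mdifferentiableAt_extend ..)
      (mdifferentiableAt_coordField _ _) ?_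
    filter_upwards [(chartAt (EuclideanSpace ℝ (Fin (n + 2))) (N.incl q)).open_source.mem_nhds
      (mem_chart_source _ _)] with y hy
    exact (Bundle.Trivialization.symmL_apply (R := ℝ) _ hy _).symm
  rw [← h1]
  exact congrArg (· + _) (Bundle.Trivialization.symmL_apply (R := ℝ) _
    (mem_chart_source _ (N.incl q)) _).symm

lemma toScreen_eq_zero_iff {z : TangentSpace (𝓡 (n + 1)) q} :
    N.toScreen q z = 0 ↔
      mfderiv (𝓡 (n + 1)) (𝓡 (n + 2)) N.incl q z ∈ h.line X (N.incl q) :=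
  Submodule.Quotient.mk_eq_zero _

lemma toScreen_surjective (q : N.carrier) : Function.Surjective (N.toScreen q) :=
  (Submodule.mkQ_surjective _).comp (N.tangentEquiv q).surjective

lemma mfderiv_incl_mem_perp (v : TangentSpace (𝓡 (n + 1)) q) :
    mfderiv (𝓡 (n + 1)) (𝓡 (n + 2)) N.incl q v ∈ h.perp X (N.incl q) :=
  N.tangent q ▸ LinearMap.mem_range_self _ v

lemma exists_extension {V : Π q : N.carrier, TangentSpace (𝓡 (n + 1)) q}
    (hV : MDifferentiableAt (𝓡 (n + 1)) (𝓡 (n + 1)).tangent (T% V) q) :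
    ∃ W : Π x : M, TangentSpace (𝓡 (n + 2)) x, MDifferentiableAt (𝓡 (n + 2)) (𝓡 (n + 2)).tangent
    (T% W) (N.incl q) ∧
      ∀ᶠ q' in 𝓝 q, mfderiv (𝓡 (n + 1)) (𝓡 (n + 2)) N.incl q' (V q') = W (N.incl q') := by
  obtain ⟨W, h1, -, h3⟩ := exists_vectorField_extension (N.contMDiff q) (N.immersion q)
    (fun q' ↦ mfderiv (𝓡 (n + 1)) (𝓡 (n + 2)) N.incl q' (V q'))
  exact ⟨W, h1 (hV.coordComp_mfderiv N.contMDiff), h3.mono fun _ ↦ Eq.symm⟩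

lemma exists_contMDiffAt_extension {V : Π q : N.carrier, TangentSpace (𝓡 (n + 1)) q}
    (hV : ContMDiffAt (𝓡 (n + 1)) (𝓡 (n + 1)).tangent ∞ (T% V) q) :
    ∃ W : Π x : M, TangentSpace (𝓡 (n + 2)) x, ContMDiffAt (𝓡 (n + 2)) (𝓡 (n + 2)).tangent ∞
    (T% W) (N.incl q) ∧
      ∀ᶠ q' in 𝓝 q, mfderiv (𝓡 (n + 1)) (𝓡 (n + 2)) N.incl q' (V q') = W (N.incl q') := by
  obtain ⟨W, -, h1, h3⟩ := exists_vectorField_extension (N.contMDiff q) (N.immersion q)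
    (fun q' ↦ mfderiv (𝓡 (n + 1)) (𝓡 (n + 2)) N.incl q' (V q'))
  exact ⟨W, h1 (hV.coordComp_mfderiv N.contMDiff), h3.mono fun _ ↦ Eq.symm⟩

variable (hX : ContMDiff (𝓡 (n + 2)) (𝓡 (n + 2)).tangent ∞ (T% X)) (hrec : h.IsRecurrent X)
include hX hrec

/-- The hyperplane distribution is parallel. -/
lemma leviCivita_mem_perp {V : Π q : N.carrier, TangentSpace (𝓡 (n + 1)) q}
    {W : Π x : M, TangentSpace (𝓡 (n + 2)) x}
    (hW : MDifferentiableAt (𝓡 (n + 2)) (𝓡 (n + 2)).tangent (T% W) (N.incl q))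
    (he : ∀ᶠ q' in 𝓝 q, mfderiv (𝓡 (n + 1)) (𝓡 (n + 2)) N.incl q' (V q') = W (N.incl q'))
    (u : TangentSpace (𝓡 (n + 1)) q) :
    h.leviCivita W (N.incl q) (mfderiv (𝓡 (n + 1)) (𝓡 (n + 2)) N.incl q u) ∈
      h.perp X (N.incl q) := by
  obtain ⟨Θ, hΘ⟩ := hrec
  have hXd : MDifferentiableAt (𝓡 (n + 2)) (𝓡 (n + 2)).tangent (T% X) (N.incl q) :=
    (hX _).mdifferentiableAt (by simp)
  set v := mfderiv (𝓡 (n + 1)) (𝓡 (n + 2)) N.incl q u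
  have h1 := h.leviCivita_metric (mdifferentiableAt_coordField (N.incl q) (coordComp (N.incl q) v))
    hW hXd
  rw [coordField_coordComp (mem_chart_source _ _), hΘ] at h1
  have hperp : ∀ᶠ q' in 𝓝 q, h.inner (N.incl q') (W (N.incl q')) (X (N.incl q')) = 0 := by
    filter_upwards [he] with q' hq'
    rw [← hq']
    exact N.mfderiv_incl_mem_perp _
  have h2 : mvfderiv (𝓡 (n + 1)) ((fun y ↦ h.inner y (W y) (X y)) ∘ N.incl) q =
      mvfderiv (𝓡 (n + 1)) (fun _ : N.carrier ↦ (0 : ℝ)) q :=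
    Filter.EventuallyEq.mfderiv_eq hperp
  have h3 := mvfderiv_comp_mfderiv q (h.mdifferentiableAt_inner hW hXd)
    (N.mdifferentiableAt_incl q) u
  rw [h2, mvfderiv_const] at h3
  have h4 : (0 : ℝ) = h.inner (N.incl q) (h.leviCivita W (N.incl q) v) (X (N.incl q)) +
    h.inner (N.incl q) (W (N.incl q)) (Θ (N.incl q) v • X (N.incl q)) := h3.trans h1
  rw [map_smul, hperp.self_of_nhds, smul_zero, add_zero] at h4
  exact h4.symm

/-- The induced connection, computed by an extension to the ambient manifold. -/
lemma mfderiv_inducedCov {V : Π q : N.carrier, TangentSpace (𝓡 (n + 1)) q}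
    {W : Π x : M, TangentSpace (𝓡 (n + 2)) x}
    (hW : MDifferentiableAt (𝓡 (n + 2)) (𝓡 (n + 2)).tangent (T% W) (N.incl q))
    (he : ∀ᶠ q' in 𝓝 q, mfderiv (𝓡 (n + 1)) (𝓡 (n + 2)) N.incl q' (V q') = W (N.incl q'))
    (u : TangentSpace (𝓡 (n + 1)) q) :
    mfderiv (𝓡 (n + 1)) (𝓡 (n + 2)) N.incl q (N.inducedCov V q u) =
      h.leviCivita W (N.incl q) (mfderiv (𝓡 (n + 1)) (𝓡 (n + 2)) N.incl q u) := by
  have h1 : N.covAlong (fun q' ↦ mfderiv (𝓡 (n + 1)) (𝓡 (n + 2)) N.incl q' (V q')) q u =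
      h.leviCivita W (N.incl q) (mfderiv (𝓡 (n + 1)) (𝓡 (n + 2)) N.incl q u) :=
    (N.covAlong_congr he u).trans (N.covAlong_comp_incl hW u)
  have h2 := N.leviCivita_mem_perp hX hrec hW he u
  rw [← N.tangent q, ← h1] at h2
  exact (Function.invFun_eq h2).trans h1

variable (hne : ∀ x, X x ≠ 0)
include hne

lemma toScreen_inducedCov_congr {V V' : Π q : N.carrier, TangentSpace (𝓡 (n + 1)) q}
    (hV : MDifferentiableAt (𝓡 (n + 1)) (𝓡 (n + 1)).tangent (T% V) q)
    (hV' : MDifferentiableAt (𝓡 (n + 1)) (𝓡 (n + 1)).tangent (T% V') q)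
    (he : ∀ q', N.toScreen q' (V q') = N.toScreen q' (V' q')) (u : TangentSpace (𝓡 (n + 1)) q) :
    N.toScreen q (N.inducedCov V q u) = N.toScreen q (N.inducedCov V' q u) := by
  obtain ⟨W, hW, eW⟩ := N.exists_extension hV
  obtain ⟨W', hW', eW'⟩ := N.exists_extension hV'
  have hmem : ∀ q', ∃ c : ℝ, c • X (N.incl q') =
      mfderiv (𝓡 (n + 1)) (𝓡 (n + 2)) N.incl q' (V q' - V' q') := fun q' ↦ by
    have h1 : N.toScreen q' (V q' - V' q') = 0 := by rw [map_sub, he, sub_self]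
    exact Submodule.mem_span_singleton.1 (N.toScreen_eq_zero_iff.1 h1)
  have hXd : MDifferentiableAt (𝓡 (n + 2)) (𝓡 (n + 2)).tangent (T% X) (N.incl q) :=
    (hX _).mdifferentiableAt (by simp)
  set p := N.incl q
  have hXp : coordComp p (X p) ≠ 0 := by
    intro h0
    apply hne p
    rw [← coordField_coordComp (mem_chart_source _ p) (X p), h0]
    exact map_zero _
  obtain ⟨ℓ, hℓ⟩ : ∃ ℓ : EuclideanSpace ℝ (Fin (n + 2)) →L[ℝ] ℝ, ℓ (coordComp p (X p)) ≠ 0 :=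
    SeparatingDual.exists_ne_zero hXp
  have hℓX : MDifferentiableAt (𝓡 (n + 2)) 𝓘(ℝ, ℝ) (fun y ↦ ℓ (coordComp p (X y))) p :=
    ℓ.differentiableAt.mdifferentiableAt.comp p (mdifferentiableAt_iff_coordComp.1 hXd)
  have hℓD : MDifferentiableAt (𝓡 (n + 2)) 𝓘(ℝ, ℝ) (fun y ↦ ℓ (coordComp p ((W - W') y))) p :=
    ℓ.differentiableAt.mdifferentiableAt.comp p (mdifferentiableAt_iff_coordComp.1
      (mdifferentiableAt_sub_section hW hW'))
  let c : M → ℝ := fun y ↦ ℓ (coordComp p ((W - W') y)) * (ℓ (coordComp p (X y)))⁻¹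
  have hc : MDifferentiableAt (𝓡 (n + 2)) 𝓘(ℝ, ℝ) c p := hℓD.mul
    ((hasFDerivAt_inv hℓ).differentiableAt.mdifferentiableAt.comp p hℓX)
  have hcX : MDifferentiableAt (𝓡 (n + 2)) (𝓡 (n + 2)).tangent (T% (c • X)) p := hc.smul_section hXd
  have hcq : ∀ᶠ q' in 𝓝 q, c (N.incl q') • X (N.incl q') = W (N.incl q') - W' (N.incl q') := by
    have h1 : ∀ᶠ q' in 𝓝 q, ℓ (coordComp p (X (N.incl q'))) ≠ 0 :=
      (hℓX.continuousAt.comp (N.contMDiff q).continuousAt).eventually_ne hℓ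
    have h2 : ∀ᶠ q' in 𝓝 q, N.incl q' ∈ (chartAt (EuclideanSpace ℝ (Fin (n + 2))) p).source :=
      (N.contMDiff q).continuousAt.preimage_mem_nhds
        ((chartAt _ p).open_source.mem_nhds (mem_chart_source _ p))
    filter_upwards [h1, h2, eW, eW'] with q' h1 h2 h3 h4
    obtain ⟨a, ha⟩ := hmem q'
    rw [map_sub, h3, h4] at ha
    have h5 : coordComp p (W (N.incl q') - W' (N.incl q')) = a • coordComp p (X (N.incl q')) := by
      rw [← ha, coordComp_eq_mfderiv_extChartAt h2, coordComp_eq_mfderiv_extChartAt h2, map_smul]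
      rfl
    have h6 : c (N.incl q') = a := by
      change ℓ (coordComp p (W (N.incl q') - W' (N.incl q'))) * _ = a
      rw [h5, map_smul, smul_eq_mul, mul_assoc, mul_inv_cancel₀ h1, mul_one]
    rw [h6, ha]
  have eV : ∀ᶠ q' in 𝓝 q, mfderiv (𝓡 (n + 1)) (𝓡 (n + 2)) N.incl q' (V q') =
      (W' + c • X) (N.incl q') := by
    filter_upwards [eW, hcq] with q' h1 h2
    rw [h1]
    change _ = W' (N.incl q') + c (N.incl q') • X (N.incl q')
    rw [h2]
    abel
  obtain ⟨Θ, hΘ⟩ := id hrec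
  rw [← sub_eq_zero, ← map_sub, N.toScreen_eq_zero_iff, map_sub,
    N.mfderiv_inducedCov hX hrec (mdifferentiableAt_add_section hW' hcX) eV,
    N.mfderiv_inducedCov hX hrec hW' eW', h.leviCivita.add_apply hW' hcX, _root_.add_apply,
    h.leviCivita.smul_apply hc hXd, hΘ, smul_smul, ← add_smul]
  exact Submodule.mem_span_singleton.2 ⟨_, (add_sub_cancel_left _ _).symm⟩

lemma screenCov_eq {V : Π q : N.carrier, TangentSpace (𝓡 (n + 1)) q}
    {s : Π q : N.carrier, h.Screen X (N.incl q)}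
    (hV : MDifferentiableAt (𝓡 (n + 1)) (𝓡 (n + 1)).tangent (T% V) q) (hs : N.Represents V s)
    (u : TangentSpace (𝓡 (n + 1)) q) :
    N.screenCov s q u = N.toScreen q (N.inducedCov V q u) := by
  have hex : ∃ V : Π q : N.carrier, TangentSpace (𝓡 (n + 1)) q,
      MDifferentiableAt (𝓡 (n + 1)) (𝓡 (n + 1)).tangent (T% V) q ∧ N.Represents V s := ⟨V, hV, hs⟩
  rw [screenCov, dif_pos hex]
  exact N.toScreen_inducedCov_congr hX hrec hne hex.choose_spec.1 hV
    (fun q' ↦ (hex.choose_spec.2 q').trans (hs q').symm) u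

lemma exists_screenCov_screenCov_eq {V W : Π q : N.carrier, TangentSpace (𝓡 (n + 1)) q}
    {V' W' : Π x : M, TangentSpace (𝓡 (n + 2)) x}
    {s : Π q : N.carrier, h.Screen X (N.incl q)} (hs : N.Represents W s)
    (hW : ContMDiffAt (𝓡 (n + 1)) (𝓡 (n + 1)).tangent ∞ (T% W) q)
    (hV' : MDifferentiableAt (𝓡 (n + 2)) (𝓡 (n + 2)).tangent (T% V') (N.incl q))
    (hW' : ContMDiffAt (𝓡 (n + 2)) (𝓡 (n + 2)).tangent ∞ (T% W') (N.incl q))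
    (eV : ∀ᶠ q' in 𝓝 q, mfderiv (𝓡 (n + 1)) (𝓡 (n + 2)) N.incl q' (V q') = V' (N.incl q'))
    (eW : ∀ᶠ q' in 𝓝 q, mfderiv (𝓡 (n + 1)) (𝓡 (n + 2)) N.incl q' (W q') = W' (N.incl q'))
    (u : TangentSpace (𝓡 (n + 1)) q) :
    ∃ z : TangentSpace (𝓡 (n + 1)) q,
      mfderiv (𝓡 (n + 1)) (𝓡 (n + 2)) N.incl q z =
        h.leviCivita (fun y ↦ h.leviCivita W' y (V' y)) (N.incl q)
          (mfderiv (𝓡 (n + 1)) (𝓡 (n + 2)) N.incl q u) ∧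
      N.screenCov (fun q' ↦ N.screenCov s q' (V q')) q u = N.toScreen q z := by
  classical
  choose ρ hρ using N.toScreen_surjective
  let Z : Π q : N.carrier, TangentSpace (𝓡 (n + 1)) q := fun q' ↦
    if N.toScreen q' (N.inducedCov W q' (V q')) = N.screenCov s q' (V q') then
      N.inducedCov W q' (V q') else ρ q' (N.screenCov s q' (V q'))
  have hZ : N.Represents Z fun q' ↦ N.screenCov s q' (V q') := fun q' ↦ by
    by_cases hq' : N.toScreen q' (N.inducedCov W q' (V q')) = N.screenCov s q' (V q')
    · simp only [Z, if_pos hq']; exact hq'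
    · simp only [Z, if_neg hq']; exact hρ _ _
  have eZ : ∀ᶠ q' in 𝓝 q, mfderiv (𝓡 (n + 1)) (𝓡 (n + 2)) N.incl q' (Z q') =
      h.leviCivita W' (N.incl q') (V' (N.incl q')) := by
    filter_upwards [eventually_mdifferentiableAt_section hW, eV, eW.eventually_nhds,
      (N.contMDiff q).continuousAt.eventually (eventually_mdifferentiableAt_section hW')]
      with q' h1 h2 h3 h4
    have h5 := N.screenCov_eq hX hrec hne h1 hs (V q')
    simp only [Z, if_pos h5.symm]
    rw [N.mfderiv_inducedCov hX hrec h4 h3, h2]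
  have hnW := h.mdifferentiableAt_leviCivita hW' hV'
  have hZd : MDifferentiableAt (𝓡 (n + 1)) (𝓡 (n + 1)).tangent (T% Z) q :=
    mdifferentiableAt_of_mfderiv_eq N.contMDiff (N.immersion q) hnW eZ
  exact ⟨_, N.mfderiv_inducedCov hX hrec hnW eZ u, N.screenCov_eq hX hrec hne hZd hZ u⟩

/-- The curvature of the screen bundle over a light-like hypersurface is induced by the ambient
curvature. -/
lemma screenCurvature_eq_zero_iff {U V W : Π q : N.carrier, TangentSpace (𝓡 (n + 1)) q}
    {U' V' W' : Π x : M, TangentSpace (𝓡 (n + 2)) x}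
    {s : Π q : N.carrier, h.Screen X (N.incl q)} (hs : N.Represents W s)
    (hU : MDifferentiableAt (𝓡 (n + 1)) (𝓡 (n + 1)).tangent (T% U) q)
    (hV : MDifferentiableAt (𝓡 (n + 1)) (𝓡 (n + 1)).tangent (T% V) q)
    (hW : ContMDiffAt (𝓡 (n + 1)) (𝓡 (n + 1)).tangent ∞ (T% W) q)
    (hU' : MDifferentiableAt (𝓡 (n + 2)) (𝓡 (n + 2)).tangent (T% U') (N.incl q))
    (hV' : MDifferentiableAt (𝓡 (n + 2)) (𝓡 (n + 2)).tangent (T% V') (N.incl q))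
    (hW' : ContMDiffAt (𝓡 (n + 2)) (𝓡 (n + 2)).tangent ∞ (T% W') (N.incl q))
    (eU : ∀ᶠ q' in 𝓝 q, mfderiv (𝓡 (n + 1)) (𝓡 (n + 2)) N.incl q' (U q') = U' (N.incl q'))
    (eV : ∀ᶠ q' in 𝓝 q, mfderiv (𝓡 (n + 1)) (𝓡 (n + 2)) N.incl q' (V q') = V' (N.incl q'))
    (eW : ∀ᶠ q' in 𝓝 q, mfderiv (𝓡 (n + 1)) (𝓡 (n + 2)) N.incl q' (W q') = W' (N.incl q')) :
    N.screenCurvature U V s q = 0 ↔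
      h.leviCivita.curvature U' V' W' (N.incl q) ∈ h.line X (N.incl q) := by
  obtain ⟨z₁, h1, e1⟩ := N.exists_screenCov_screenCov_eq hX hrec hne hs hW hV' hW' eV eW (U q)
  obtain ⟨z₂, h2, e2⟩ := N.exists_screenCov_screenCov_eq hX hrec hne hs hW hU' hW' eU eW (V q)
  have h3 := N.mfderiv_inducedCov hX hrec (hW'.mdifferentiableAt (by simp)) eW
    (mlieBracket (𝓡 (n + 1)) U V q)
  rw [screenCurvature, e1, e2, N.screenCov_eq hX hrec hne (hW.mdifferentiableAt (by simp)) hs,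
    ← map_sub, ← map_sub, N.toScreen_eq_zero_iff, map_sub, map_sub, h1, h2, h3,
    mfderiv_mlieBracket_of_related N.contMDiff hU hV hU' hV' eU eV, eU.self_of_nhds,
    eV.self_of_nhds]
  rfl

end LightlikeHypersurface
end ScreenCurvature

section CoordinateForm

open Set Filter

variable {E : Type*} [NormedAddCommGroup E] [NormedSpace ℝ E] [FiniteDimensional ℝ E]
  {H : Type*} [TopologicalSpace H] {I : ModelWithCorners ℝ E H} [I.Boundaryless]
  {M : Type*} [TopologicalSpace M] [ChartedSpace H M] [IsManifold I ∞ M] {p y : M}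

/-- The coordinate vector fields commute. -/
lemma mlieBracket_coordField (hy : y ∈ (chartAt H p).source) (a b : E) :
    mlieBracket I (coordField (I := I) p a) (coordField p b) y = 0 := by
  have : IsManifold I 1 M := IsManifold.of_le (n := ∞) (by simp)
  have : IsManifold I 2 M := IsManifold.of_le (n := ∞) (WithTop.coe_le_coe.2 le_top)
  let f : M → E := extChartAt I p
  have hf : CMDiffAt 2 f y := contMDiffAt_extChartAt' hy
  have hd : ∀ a : E, MDiffAt (T% (coordField (I := I) p a)) y := fun a ↦
    (contMDiffAt_coordField hy a).mdifferentiableAt (by simp)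
  have hc : ∀ a : E, d% (fun z ↦ d% f z (coordField (I := I) p a z)) y = 0 := by
    intro a
    have h1 : (fun z ↦ d% f z (coordField (I := I) p a z)) =ᶠ[𝓝 y] fun _ ↦ a := by
      filter_upwards [(chartAt H p).open_source.mem_nhds hy] with z hz
      exact (coordComp_eq_mfderiv_extChartAt hz _).symm.trans (coordComp_coordField hz a)
    have h2 : d% (fun z ↦ d% f z (coordField (I := I) p a z)) y = d% (fun _ : M ↦ a) y :=
      h1.mfderiv_eq
    rw [h2, mvfderiv_const]
  have h1 := mvfderiv_mlieBracket hf (hd a) (hd b)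
  rw [hc, hc] at h1
  obtain ⟨e, he⟩ := isInvertible_mfderiv_extChartAt (I := I) (x := p) (y := y)
    (by rwa [extChartAt_source])
  have hi : Function.Injective (mfderiv I 𝓘(ℝ, E) (extChartAt I p) y) := by
    rw [← he]
    exact e.injective
  refine hi (Eq.trans ?_ (map_zero (mfderiv I 𝓘(ℝ, E) (extChartAt I p) y)).symm)
  refine Eq.trans h1 ?_
  exact sub_self _

lemma mfderiv_extChartAt_symm_apply {z : E} (hz : z ∈ (extChartAt I p).target) (a : E) :
    mfderiv 𝓘(ℝ, E) I (extChartAt I p).symm z a = coordField p a ((extChartAt I p).symm z) := by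
  have : IsManifold I 1 M := IsManifold.of_le (n := ∞) (by simp)
  have hy : (extChartAt I p).symm z ∈ (chartAt H p).source := by
    simpa using (extChartAt I p).map_target hz
  have h1 := TangentBundle.symmL_trivializationAt (I := I) hy
  rw [I.range_eq_univ, mfderivWithin_univ, (extChartAt I p).right_inv hz] at h1
  exact (congrArg (fun f : E →L[ℝ] E ↦ f a) h1).symm

lemma mdifferentiableAt_extChartAt_symm' {z : E} (hz : z ∈ (extChartAt I p).target) :
    MDifferentiableAt 𝓘(ℝ, E) I (extChartAt I p).symm z := by
  have : IsManifold I 1 M := IsManifold.of_le (n := ∞) (by simp)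
  have h := mdifferentiableWithinAt_extChartAt_symm (I := I) hz
  rwa [I.range_eq_univ, mdifferentiableWithinAt_univ] at h

lemma contMDiffAt_extChartAt_symm {z : E} (hz : z ∈ (extChartAt I p).target) :
    ContMDiffAt 𝓘(ℝ, E) I ∞ (extChartAt I p).symm z :=
  (contMDiffOn_extChartAt_symm p).contMDiffAt
    ((isOpen_extChartAt_target p).mem_nhds hz)

variable (h : LorentzianMetric I M) (X : Π x : M, TangentSpace I x)

/-- The one-form `h(X, ·)` in the coordinate frame around `p`. -/
def metricForm (p y : M) : E →L[ℝ] ℝ :=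
  (h.inner y (X y)).comp ((trivializationAt E (TangentSpace I : M → Type _) p).symmL ℝ y)

lemma metricForm_apply (p y : M) (a : E) :
    metricForm h X p y a = h.inner y (X y) (coordField p a y) := rfl

variable {X}

lemma contMDiffAt_metricForm (hX : CMDiff ∞ (T% X)) (hy : y ∈ (chartAt H p).source) :
    CMDiffAt ∞ (metricForm h X p) y :=
  .clm_of_apply fun a ↦ h.contMDiffAt_inner le_rfl (hX y) (contMDiffAt_coordField hy a)

lemma contDiffOn_metricForm_comp (hX : CMDiff ∞ (T% X)) :
    ContDiffOn ℝ ∞ (metricForm h X p ∘ (extChartAt I p).symm) (extChartAt I p).target := by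
  intro z hz
  have hy : (extChartAt I p).symm z ∈ (chartAt H p).source := by
    simpa using (extChartAt I p).map_target hz
  exact ((contMDiffAt_metricForm h hX hy).comp z
    (contMDiffAt_extChartAt_symm hz)).contDiffAt.contDiffWithinAt

/-- The exterior derivative of `h(X, ·)` vanishes on the kernel, if `X` is recurrent. -/
lemma fderiv_metricForm_comp_comm (hX : CMDiff ∞ (T% X)) (hrec : h.IsRecurrent X) {z : E}
    (hz : z ∈ (extChartAt I p).target) {u v : E}
    (hu : metricForm h X p ((extChartAt I p).symm z) u = 0)
    (hv : metricForm h X p ((extChartAt I p).symm z) v = 0) :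
    fderiv ℝ (metricForm h X p ∘ (extChartAt I p).symm) z u v =
      fderiv ℝ (metricForm h X p ∘ (extChartAt I p).symm) z v u := by
  obtain ⟨Θ, hΘ⟩ := hrec
  have hy : (extChartAt I p).symm z ∈ (chartAt H p).source := by
    simpa using (extChartAt I p).map_target hz
  set y := (extChartAt I p).symm z with hydef
  have hXd : MDiffAt (T% X) y := (hX y).mdifferentiableAt (by simp)
  have hd : ∀ a : E, MDiffAt (T% (coordField (I := I) p a)) y := fun a ↦
    (contMDiffAt_coordField hy a).mdifferentiableAt (by simp)
  have hη := (contMDiffAt_metricForm h hX hy).mdifferentiableAt (by simp)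
  have hder : ∀ a b : E, metricForm h X p y b = 0 →
      fderiv ℝ (metricForm h X p ∘ (extChartAt I p).symm) z a b =
        h.inner y (X y) (h.leviCivita (coordField p b) y (coordField p a y)) := by
    intro a b hb
    have h1 := ((contDiffOn_metricForm_comp h hX (p := p)).contDiffAt
      ((isOpen_extChartAt_target p).mem_nhds hz)).differentiableAt (by simp)
    have h2 : fderiv ℝ (fun z ↦ metricForm h X p ((extChartAt I p).symm z) b) z a =
        fderiv ℝ (metricForm h X p ∘ (extChartAt I p).symm) z a b := by
      have := h1.hasFDerivAt.clm_apply (hasFDerivAt_const b z)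
      refine (congrArg (fun f : E →L[ℝ] ℝ ↦ f a) this.fderiv).trans ?_
      simp
    have h3 : MDiffAt (fun y ↦ metricForm h X p y b) y :=
      h.mdifferentiableAt_inner hXd (hd b)
    have h4 := mvfderiv_comp_mfderiv z h3 (mdifferentiableAt_extChartAt_symm' hz) a
    rw [mfderiv_extChartAt_symm_apply hz, ← hydef] at h4
    have h5 := h.leviCivita_metric (hd a) hXd (hd b)
    rw [hΘ, map_smul, smul_apply, ← metricForm_apply h X, hb, smul_zero, zero_add] at h5
    rw [← h2, ← mfderiv_eq_fderiv]
    exact h4.trans h5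
  have htor := h.leviCivita_torsionFree (hd u) (hd v)
  rw [mlieBracket_coordField hy, sub_eq_zero] at htor
  rw [hder u v hv, hder v u hu, htor]

end CoordinateForm

section Existence

open Set Filter

variable {n : ℕ} {M : Type u} [TopologicalSpace M]
  [ChartedSpace (EuclideanSpace ℝ (Fin (n + 2))) M] [IsManifold (𝓡 (n + 2)) ∞ M]

lemma LorentzianMetric.finrank_perp_le (h : LorentzianMetric (𝓡 (n + 2)) M)
    {X : Π x : M, TangentSpace (𝓡 (n + 2)) x} {x : M} (hne : X x ≠ 0) :
    finrank ℝ (h.perp X x) ≤ n + 1 := by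
  have h1 : h.perp X x ≠ ⊤ := by
    intro htop
    refine hne (h.eq_zero_of_inner fun w ↦ ?_)
    have hw : w ∈ h.perp X x := htop ▸ Submodule.mem_top
    rw [h.symm]
    exact hw
  have : FiniteDimensional ℝ (TangentSpace (𝓡 (n + 2)) x) :=
    inferInstanceAs (FiniteDimensional ℝ (EuclideanSpace ℝ (Fin (n + 2))))
  have h2 := Submodule.finrank_lt h1
  have h3 : finrank ℝ (TangentSpace (𝓡 (n + 2)) x) = n + 2 :=
    (finrank_euclideanSpace_fin (𝕜 := ℝ) (n := n + 2))
  omega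

namespace LightlikeHypersurface

variable {h : LorentzianMetric (𝓡 (n + 2)) M} {X : Π x : M, TangentSpace (𝓡 (n + 2)) x}

/-- The light-like hypersurface with a global parametrization `τ`, defined on `B ⊆ ℝⁿ⁺¹`. -/
lemma exists_of_parametrization (hne : ∀ x, X x ≠ 0) {B : Set (EuclideanSpace ℝ (Fin (n + 1)))}
    (hB : IsOpen B) (hconn : IsConnected B) {τ : EuclideanSpace ℝ (Fin (n + 1)) → M}
    (hτ : ∀ y ∈ B, ContMDiffAt (𝓡 (n + 1)) (𝓡 (n + 2)) ∞ τ y) (hinj : InjOn τ B)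
    (himm : ∀ y ∈ B, Function.Injective (mfderiv (𝓡 (n + 1)) (𝓡 (n + 2)) τ y))
    (hperp : ∀ y ∈ B, ∀ v, mfderiv (𝓡 (n + 1)) (𝓡 (n + 2)) τ y v ∈ h.perp X (τ y)) :
    ∃ N : LightlikeHypersurface h X, τ '' B ⊆ range N.incl := by
  let f : ULift.{u} B → EuclideanSpace ℝ (Fin (n + 1)) := fun q ↦ q.down
  have hf : Topology.IsOpenEmbedding f :=
    hB.isOpenEmbedding_subtypeVal.comp Homeomorph.ulift.isOpenEmbedding
  have hBc : ConnectedSpace B := isConnected_iff_connectedSpace.1 hconn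
  have : Nonempty (ULift.{u} B) := ⟨⟨hBc.toNonempty.some⟩⟩
  let _ : ChartedSpace (EuclideanSpace ℝ (Fin (n + 1))) (ULift.{u} B) := hf.singletonChartedSpace
  have : IsManifold (𝓡 (n + 1)) ∞ (ULift.{u} B) := hf.isManifold_singleton
  have : IsManifold (𝓡 (n + 1)) 1 (ULift.{u} B) := hf.isManifold_singleton
  have : ConnectedSpace (ULift.{u} B) :=
    (Homeomorph.ulift (X := B)).symm.surjective.connectedSpace
      (Homeomorph.ulift (X := B)).symm.continuous
  have hchart : ∀ q : ULift.{u} B, (extChartAt (𝓡 (n + 1)) q : _ → _) = f := fun q ↦ rfl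
  have hfc : ContMDiff (𝓡 (n + 1)) (𝓡 (n + 1)) ∞ f := fun q ↦
    contMDiffAt_extChartAt (x := q)
  have hcomp : ∀ q, mfderiv (𝓡 (n + 1)) (𝓡 (n + 2)) (τ ∘ f) q =
      (mfderiv (𝓡 (n + 1)) (𝓡 (n + 2)) τ (f q)).comp
        (mfderiv (𝓡 (n + 1)) (𝓡 (n + 1)) f q) := fun q ↦
    mfderiv_comp q ((hτ _ q.down.2).mdifferentiableAt (by simp))
      ((hfc q).mdifferentiableAt (by simp))
  have himm' : ∀ q, Function.Injective (mfderiv (𝓡 (n + 1)) (𝓡 (n + 2)) (τ ∘ f) q) := by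
    intro q
    obtain ⟨e, he⟩ := isInvertible_mfderiv_extChartAt (I := 𝓡 (n + 1)) (x := q) (y := q)
      (mem_extChartAt_source q)
    rw [hcomp]
    have hi : Function.Injective (mfderiv (𝓡 (n + 1)) (𝓡 (n + 1)) f q) := by
      change Function.Injective (mfderiv (𝓡 (n + 1)) (𝓡 (n + 1)) (extChartAt (𝓡 (n + 1)) q) q)
      rw [← he]
      exact e.injective
    exact (himm _ q.down.2).comp hi
  refine ⟨{ carrier := ULift.{u} B
            incl := τ ∘ f
            injective := fun a b hab ↦ hf.injective (hinj a.down.2 b.down.2 hab)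
            contMDiff := fun q ↦ (hτ _ q.down.2).comp q (hfc q)
            immersion := himm'
            tangent := fun q ↦ ?_ }, ?_⟩
  · have : FiniteDimensional ℝ (TangentSpace (𝓡 (n + 2)) ((τ ∘ f) q)) :=
      inferInstanceAs (FiniteDimensional ℝ (EuclideanSpace ℝ (Fin (n + 2))))
    refine Submodule.eq_of_le_of_finrank_le ?_ ?_
    · rintro _ ⟨v, rfl⟩
      have h1 := hperp (f q) q.down.2 (mfderiv (𝓡 (n + 1)) (𝓡 (n + 1)) f q v)
      have h2 := congrArg (fun g : EuclideanSpace ℝ (Fin (n + 1)) →L[ℝ]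
        EuclideanSpace ℝ (Fin (n + 2)) ↦ g v) (hcomp q)
      exact h2 ▸ h1
    · have h1 := LinearMap.finrank_range_of_inj (himm' q)
      have h3 : finrank ℝ (TangentSpace (𝓡 (n + 1)) q) = n + 1 :=
        (finrank_euclideanSpace_fin (𝕜 := ℝ) (n := n + 1))
      exact (h.finrank_perp_le (hne _)).trans (h3.symm.trans h1.symm).le
  · rintro _ ⟨y, hy, rfl⟩
    exact ⟨⟨⟨y, hy⟩⟩, rfl⟩

theorem exists_mem_range (hX : ContMDiff (𝓡 (n + 2)) (𝓡 (n + 2)).tangent ∞ (T% X))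
    (hrec : h.IsRecurrent X) (hne : ∀ x, X x ≠ 0) (p : M) :
    ∃ N : LightlikeHypersurface h X, p ∈ range N.incl := by
  set φ := extChartAt (𝓡 (n + 2)) p
  have hp : φ p ∈ φ.target := mem_extChartAt_target p
  have hpp : φ.symm (φ p) = p := φ.left_inv (mem_extChartAt_source p)
  have hξ₀ : (metricForm h X p ∘ φ.symm) (φ p) ≠ 0 := by
    rw [Function.comp_apply, hpp]
    intro h0
    refine hne p (h.eq_zero_of_inner fun w ↦ ?_)
    have h1 := metricForm_apply h X p p (coordComp p w)
    rw [h0, coordField_coordComp (mem_chart_source _ p)] at h1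
    exact h1.symm
  obtain ⟨r, hr, σ, hσ₀, hσ, hσt, hσi, hσd⟩ := exists_integral_hypersurface
    (G := EuclideanSpace ℝ (Fin (n + 1))) (by simp) (isOpen_extChartAt_target p)
    (contDiffOn_metricForm_comp h hX (p := p)) hp hξ₀
    (fun z hz u v hu hv ↦ fderiv_metricForm_comp_comm h hX hrec hz hu hv)
  have hσc : ∀ y ∈ Metric.ball 0 r, ContMDiffAt (𝓡 (n + 1)) (𝓡 (n + 2)) ∞ σ y := fun y hy ↦
    (hσ.contDiffAt (Metric.isOpen_ball.mem_nhds hy)).contMDiffAt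
  have hcomp : ∀ y ∈ Metric.ball 0 r, ∀ v, mfderiv (𝓡 (n + 1)) (𝓡 (n + 2)) (φ.symm ∘ σ) y v =
      coordField p (fderiv ℝ σ y v) (φ.symm (σ y)) := by
    intro y hy v
    rw [← mfderiv_extChartAt_symm_apply (hσt hy), ← mfderiv_eq_fderiv]
    exact mfderiv_comp_apply y (mdifferentiableAt_extChartAt_symm' (hσt hy))
      ((hσc y hy).mdifferentiableAt (by simp)) v
  have hsrc : ∀ y ∈ Metric.ball 0 r, φ.symm (σ y) ∈
      (chartAt (EuclideanSpace ℝ (Fin (n + 2))) p).source := fun y hy ↦ by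
    rw [← extChartAt_source (𝓡 (n + 2))]
    exact φ.map_target (hσt hy)
  obtain ⟨N, hN⟩ := exists_of_parametrization (h := h) hne Metric.isOpen_ball
    (Metric.isConnected_ball hr) (τ := φ.symm ∘ σ)
    (fun y hy ↦ (contMDiffAt_extChartAt_symm (hσt hy)).comp y (hσc y hy))
    (fun a ha b hb hab ↦ hσi (φ.symm.injOn (hσt ha) (hσt hb) hab))
    (fun y hy a b hab ↦ by
      rw [hcomp y hy, hcomp y hy] at hab
      refine (hσd y hy).1 ?_
      rw [← coordComp_coordField (I := 𝓡 (n + 2)) (hsrc y hy) (fderiv ℝ σ y a), hab,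
        coordComp_coordField (hsrc y hy)])
    (fun y hy v ↦ by
      rw [hcomp y hy]
      exact (h.symm _ _ _).trans ((hσd y hy).2 v))
  refine ⟨N, hN ⟨0, Metric.mem_ball_self hr, ?_⟩⟩
  rw [Function.comp_apply, hσ₀, hpp]

end LightlikeHypersurface
end Existence

section LightlikeCurvature

open Set Filter

variable {n : ℕ} {M : Type u} [TopologicalSpace M]
  [ChartedSpace (EuclideanSpace ℝ (Fin (n + 2))) M] [IsManifold (𝓡 (n + 2)) ∞ M]
  {h : LorentzianMetric (𝓡 (n + 2)) M} {X : Π x : M, TangentSpace (𝓡 (n + 2)) x}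

lemma LorentzianMetric.HasLightlikeHypersurfaceCurvature.isScreenFlat
    (hcurv : h.HasLightlikeHypersurfaceCurvature X)
    (hX : ContMDiff (𝓡 (n + 2)) (𝓡 (n + 2)).tangent ∞ (T% X)) (hrec : h.IsRecurrent X)
    (hne : ∀ x, X x ≠ 0) (N : LightlikeHypersurface h X) : N.IsScreenFlat := by
  rintro q U V s hU hV ⟨W, hW, hs⟩
  obtain ⟨U', hU', eU⟩ := N.exists_contMDiffAt_extension hU
  obtain ⟨V', hV', eV⟩ := N.exists_contMDiffAt_extension hV
  obtain ⟨W', hW', eW⟩ := N.exists_contMDiffAt_extension hW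
  rw [N.screenCurvature_eq_zero_iff hX hrec hne hs (hU.mdifferentiableAt (by simp))
    (hV.mdifferentiableAt (by simp)) hW (hU'.mdifferentiableAt (by simp))
    (hV'.mdifferentiableAt (by simp)) hW' eU eV eW]
  refine hcurv (N.incl q) U' V' W' hU' hV' hW' ?_ ?_ ?_
  · exact eU.self_of_nhds ▸ N.mfderiv_incl_mem_perp _
  · exact eV.self_of_nhds ▸ N.mfderiv_incl_mem_perp _
  · exact eW.self_of_nhds ▸ N.mfderiv_incl_mem_perp _

/-- A vector of the hyperplane `Ξ^⊥` extends to a vector field tangent to a light-like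
hypersurface. -/
lemma LightlikeHypersurface.exists_tangent_extension (N : LightlikeHypersurface h X)
    {q : N.carrier} {u : TangentSpace (𝓡 (n + 2)) (N.incl q)} (hu : u ∈ h.perp X (N.incl q)) :
    ∃ (U : Π q : N.carrier, TangentSpace (𝓡 (n + 1)) q) (U' : Π x : M, TangentSpace (𝓡 (n + 2)) x),
      ContMDiffAt (𝓡 (n + 1)) (𝓡 (n + 1)).tangent ∞ (T% U) q ∧
      ContMDiffAt (𝓡 (n + 2)) (𝓡 (n + 2)).tangent ∞ (T% U') (N.incl q) ∧ U' (N.incl q) = u ∧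
      ∀ᶠ q' in 𝓝 q, mfderiv (𝓡 (n + 1)) (𝓡 (n + 2)) N.incl q' (U q') = U' (N.incl q') := by
  rw [← N.tangent q] at hu
  obtain ⟨v, hv⟩ := hu
  have hU := contMDiffAt_coordField (I := 𝓡 (n + 1)) (mem_chart_source _ q) (coordComp q v)
  obtain ⟨U', hU', eU⟩ := N.exists_contMDiffAt_extension hU
  refine ⟨_, U', hU, hU', ?_, eU⟩
  rw [← eU.self_of_nhds, coordField_coordComp (mem_chart_source _ q)]
  exact hv

lemma LorentzianMetric.hasLightlikeHypersurfaceCurvature_of_isScreenFlat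
    (hX : ContMDiff (𝓡 (n + 2)) (𝓡 (n + 2)).tangent ∞ (T% X)) (hrec : h.IsRecurrent X)
    (hne : ∀ x, X x ≠ 0)
    (hflat : ∀ p : M, ∃ N : LightlikeHypersurface h X, p ∈ range N.incl ∧ N.IsScreenFlat) :
    h.HasLightlikeHypersurfaceCurvature X := by
  intro x U V W hU hV hW hUx hVx hWx
  obtain ⟨N, ⟨q, rfl⟩, hN⟩ := hflat x
  obtain ⟨U₀, U', hU₀, hU', eUx, eU⟩ := N.exists_tangent_extension hUx
  obtain ⟨V₀, V', hV₀, hV', eVx, eV⟩ := N.exists_tangent_extension hVx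
  obtain ⟨W₀, W', hW₀, hW', eWx, eW⟩ := N.exists_tangent_extension hWx
  have hs : N.Represents W₀ fun q ↦ N.toScreen q (W₀ q) := fun q ↦ rfl
  have h1 := hN q U₀ V₀ _ hU₀ hV₀ ⟨W₀, hW₀, hs⟩
  rw [N.screenCurvature_eq_zero_iff hX hrec hne hs (hU₀.mdifferentiableAt (by simp))
    (hV₀.mdifferentiableAt (by simp)) hW₀ (hU'.mdifferentiableAt (by simp))
    (hV'.mdifferentiableAt (by simp)) hW' eU eV eW] at h1
  rwa [h.curvature_congr (hU.mdifferentiableAt (by simp)) (hV.mdifferentiableAt (by simp)) hW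
    (hU'.mdifferentiableAt (by simp)) (hV'.mdifferentiableAt (by simp)) hW' eUx.symm eVx.symm
    eWx.symm]

end LightlikeCurvature

end

theorem proposition7 {n : ℕ} {M : Type u} [TopologicalSpace M] [T2Space M]
    [SecondCountableTopology M] [ChartedSpace (EuclideanSpace ℝ (Fin (n + 2))) M]
    [IsManifold (𝓡 (n + 2)) ∞ M] (h : LorentzianMetric (𝓡 (n + 2)) M)
    (X : Π x : M, TangentSpace (𝓡 (n + 2)) x)
    (hX : ContMDiff (𝓡 (n + 2)) (𝓡 (n + 2)).tangent ∞ (T% X)) (hlight : h.IsLightlike X) (hrec : h.IsRecurrent X) :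
    (h.HasLightlikeHypersurfaceCurvature X ↔
      ∀ N : LightlikeHypersurface h X, N.IsScreenFlat) ∧
    (h.HasLightlikeHypersurfaceCurvature X ↔
      ∀ p : M, ∃ N : LightlikeHypersurface h X, p ∈ Set.range N.incl ∧ N.IsScreenFlat) := by
  have hne : ∀ x, X x ≠ 0 := fun x ↦ (hlight x).1
  have hex := LightlikeHypersurface.exists_mem_range hX hrec hne
  have hto := fun hcurv : h.HasLightlikeHypersurfaceCurvature X ↦ hcurv.isScreenFlat hX hrec hne
  have hfrom := h.hasLightlikeHypersurfaceCurvature_of_isScreenFlat hX hrec hne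
  refine ⟨⟨hto, fun hN ↦ hfrom fun p ↦ ?_⟩, ⟨fun hcurv p ↦ ?_, hfrom⟩⟩
  · obtain ⟨N, hp⟩ := hex p
    exact ⟨N, hp, hN N⟩
  · obtain ⟨N, hp⟩ := hex p
    exact ⟨N, hp, hto hcurv N⟩
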